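/- Let $\Delta\subset\mathbb C$ be the unit disk and $\Delta^n\subset\mathbb C^n$ the unit polydisk, i.e. the open unit ball of the sup norm $\|z\|=\max_j|z_j|$. Let $\omega(\zeta,\eta)=\frac12\log\frac{1+\rho}{1-\rho}$, $\rho=\left|\frac{\eta-\zeta}{1-\bar\zeta\eta}\right|$, be the Poincaré distance of $\Delta$ and $k(z,w)=\max_j\omega(z_j,w_j)$ the Kobayashi distance of $\Delta^n$. Let $x\in\partial\Delta^n$. A component $x_j$ is a Šilov component of $x$ if $|x_j|=1$. Let $d_x\ge1$ be the number of Šilov components of $x$, and put $$\tilde p_x(z)=\frac1{d_x}\sum_{|x_j|=1}z_j\overline{x_j},\qquad p_x(z)=\tilde p_x(z)\,x .$$ An $x$-curve is a continuous curve $\sigma:[0,1)\to\Delta^n$ with $\sigma(t)\to x$ as $t\to1^-$. It is * special if $k\bigl(\sigma(t),p_x(\sigma(t))\bigr)\to0$ as $t\to1^-$; * restricted if $\tilde p_x\circ\sigma$ tends to $1$ non-tangentially in $\Delta$, i.e. if for some $M>1$ one has $|1-\tilde p_x(\sigma(t))|<M\,(1-|\tilde p_x(\sigma(t))|)$ for all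 $t$ close to $1$; * peculiar if for every $R>0$ the point $\sigma(t)$ belongs, for all $t$ close to $1$, to the horosphere $$E(x,R)=\Bigl\{z\in\Delta^n:\ \limsup_{w\to x}\,[k(z,w)-k(0,w)]<\tfrac12\log R\Bigr\}.$$ A function $g:\Delta^n\to\mathbb C$ has restricted $K$-limit $L$ at $x$ if $g(\sigma(t))\to L$ as $t\to1^-$ for every special restricted $x$-curve $\sigma$, and restricted $E$-limit $L$ at $x$ if $g(\sigma(t))\to L$ as $t\to1^-$ for every peculiar $x$-curve $\sigma$. For $0<\alpha<+\infty$, a holomorphic function $f:\Delta^n\to\Delta$ is $\alpha$-Julia at $x$ if $$\liminf_{w\to x}\,\bigl[k(0,w)-\omega(0,f(w))\bigr]=\tfrac12\log\alpha .$$ **Proposition 4.9.** Let $f:\Delta^n\to\Delta$ be holomorphic and $\alpha$-Julia at $x\in\partial\Delta^n$, and let $\tau\in\partial\Delta$ be its restricted $E$-limit at $x$. Let $x_j$ be a Šilov component of $x$. Then there is a real number $\beta\ge0$ such that $\partial f/\partial z_j$ has restricted $K$-limit $\beta\,\tau\,\overline{x_j}$ at $x$. -/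

import Mathlib

open Filter Topology

namespace Polydisk

/-- The unit polydisk `Δⁿ`: the open unit ball of `ℂⁿ` for the sup norm
(the norm of `Fin n → ℂ` in Mathlib is the sup norm). -/
def polydisk (n : ℕ) : Set (Fin n → ℂ) := Metric.ball 0 1

/-- The unit disk `Δ ⊂ ℂ`. -/
def disk : Set ℂ := Metric.ball 0 1

/-- The Poincaré distance `ω` of the unit disk. -/
noncomputable def poincareDist (ζ η : ℂ) : ℝ :=
  (1 / 2) * Real.log
    ((1 + ‖(η - ζ) / (1 - (starRingEnd ℂ) ζ * η)‖) / (1 - ‖(η - ζ) / (1 - (starRingEnd ℂ) ζ * η)‖))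

/-- The automorphism `γ_z` of the polydisk, sending `z` to the origin. -/
noncomputable def gamma {n : ℕ} (z w : Fin n → ℂ) : Fin n → ℂ :=
  fun j => (w j - z j) / (1 - (starRingEnd ℂ) (z j) * w j)

/-- The Kobayashi distance of the polydisk, `½ log ((1 + ‖γ_z(w)‖) / (1 - ‖γ_z(w)‖))` with the
sup norm; equivalently the maximum over `j` of the Poincaré distances of `z j` and `w j`. -/
noncomputable def kobayashiDist {n : ℕ} (z w : Fin n → ℂ) : ℝ :=
  (1 / 2) * Real.log ((1 + ‖gamma z w‖) / (1 - ‖gamma z w‖))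

/-- `x j` is a Šilov component of `x`. -/
def IsSilovComponent {n : ℕ} (x : Fin n → ℂ) (j : Fin n) : Prop := ‖x j‖ = 1

/-- The Šilov degree `d_x`: the number of components of `x` of absolute value `1`. -/
noncomputable def silovDegree {n : ℕ} (x : Fin n → ℂ) : ℕ :=
  (Finset.univ.filter fun j => ‖x j‖ = 1).card

/-- The Šilov part of `x`: the components of absolute value less than `1` are replaced by `0`. -/
noncomputable def silovPart {n : ℕ} (x : Fin n → ℂ) : Fin n → ℂ :=
  fun j => if ‖x j‖ = 1 then x j else 0

/-- The left-inverse function `p̃_x(z) = (z, x̌) / d_x` associated to `x`, where `(·,·)` is the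
canonical hermitian product (linear in the first variable) and `x̌` is the Šilov part of `x`. -/
noncomputable def leftInv {n : ℕ} (x z : Fin n → ℂ) : ℂ :=
  (1 / (silovDegree x : ℂ)) * ∑ j, z j * (starRingEnd ℂ) (silovPart x j)

/-- The holomorphic retraction `p_x(z) = p̃_x(z) x` associated to `x`. -/
noncomputable def retraction {n : ℕ} (x z : Fin n → ℂ) : Fin n → ℂ := leftInv x z • x

/-- An `x`-curve: a continuous curve `σ : [0,1) → Δⁿ` with `σ(t) → x` as `t → 1⁻`.
Only the values of `σ` on `[0,1)` matter. -/
structure IsCurveTo {n : ℕ} (x : Fin n → ℂ) (σ : ℝ → Fin n → ℂ) : Prop where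
  continuousOn : ContinuousOn σ (Set.Ico 0 1)
  mapsTo : Set.MapsTo σ (Set.Ico 0 1) (polydisk n)
  tendsto : Tendsto σ (𝓝[<] 1) (𝓝 x)

/-- A curve is special if `k(σ(t), σ_x(t)) → 0`, where `σ_x = p_x ∘ σ`. -/
def IsSpecial {n : ℕ} (x : Fin n → ℂ) (σ : ℝ → Fin n → ℂ) : Prop :=
  Tendsto (fun t => kobayashiDist (σ t) (retraction x (σ t))) (𝓝[<] 1) (𝓝 0)

/-- The Stolz region `H(τ, M)` of vertex `τ` and amplitude `M` in the unit disk. -/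
def stolz (τ : ℂ) (M : ℝ) : Set ℂ := {ζ | ζ ∈ disk ∧ ‖τ - ζ‖ / (1 - ‖ζ‖) < M}

/-- A curve is restricted if `σ̃_x = p̃_x ∘ σ` approaches `1` non-tangentially, that is, if it is
eventually contained in some Stolz region of vertex `1`. -/
def IsRestricted {n : ℕ} (x : Fin n → ℂ) (σ : ℝ → Fin n → ℂ) : Prop :=
  ∃ M : ℝ, 1 < M ∧ ∀ᶠ t in 𝓝[<] (1 : ℝ), leftInv x (σ t) ∈ stolz 1 M

/-- `g` has restricted `K`-limit `L` at `x`. -/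
def HasRestrictedKLimit {n : ℕ} (g : (Fin n → ℂ) → ℂ) (x : Fin n → ℂ) (L : ℂ) : Prop :=
  ∀ σ : ℝ → Fin n → ℂ, IsCurveTo x σ → IsSpecial x σ → IsRestricted x σ →
    Tendsto (fun t => g (σ t)) (𝓝[<] 1) (𝓝 L)

/-- The (small) horosphere `E(x, R)` of center `x` and radius `R`; the upper limit is taken in the
extended reals, over points `w` of the polydisk. -/
def horosphere {n : ℕ} (x : Fin n → ℂ) (R : ℝ) : Set (Fin n → ℂ) :=
  {z | z ∈ polydisk n ∧
    limsup (fun w => ((kobayashiDist z w - kobayashiDist 0 w : ℝ) : EReal)) (𝓝[polydisk n] x)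
      < (((1 / 2) * Real.log R : ℝ) : EReal)}

/-- A curve is peculiar if it eventually enters every horosphere centered at `x`. -/
def IsPeculiar {n : ℕ} (x : Fin n → ℂ) (σ : ℝ → Fin n → ℂ) : Prop :=
  ∀ R : ℝ, 0 < R → ∀ᶠ t in 𝓝[<] (1 : ℝ), σ t ∈ horosphere x R

/-- `g` has restricted `E`-limit `L` at `x`. -/
def HasRestrictedELimit {n : ℕ} (g : (Fin n → ℂ) → ℂ) (x : Fin n → ℂ) (L : ℂ) : Prop :=
  ∀ σ : ℝ → Fin n → ℂ, IsCurveTo x σ → IsPeculiar x σ →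
    Tendsto (fun t => g (σ t)) (𝓝[<] 1) (𝓝 L)

/-- `f ∈ Hol(Δⁿ, Δ)`. Only the values of `f` on the polydisk matter. -/
structure IsHol {n : ℕ} (f : (Fin n → ℂ) → ℂ) : Prop where
  differentiableOn : DifferentiableOn ℂ f (polydisk n)
  mapsTo : Set.MapsTo f (polydisk n) disk

/-- `f` is `α`-Julia at `x`: `liminf_{w → x} [k(0, w) - ω(0, f(w))] = ½ log α`, a finite number.
The lower limit is taken in the extended reals, over points `w` of the polydisk. -/
def IsJulia {n : ℕ} (α : ℝ) (f : (Fin n → ℂ) → ℂ) (x : Fin n → ℂ) : Prop :=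
  0 < α ∧
    liminf (fun w => ((kobayashiDist 0 w - poincareDist 0 (f w) : ℝ) : EReal)) (𝓝[polydisk n] x)
      = (((1 / 2) * Real.log α : ℝ) : EReal)

/-- The complex partial derivative `∂f/∂z_j`. -/
noncomputable def partialDeriv {n : ℕ} (f : (Fin n → ℂ) → ℂ) (j : Fin n) (z : Fin n → ℂ) : ℂ :=
  fderiv ℂ f z (Pi.single j 1)

end Polydisk

/-!
Multiplying `f` by `conj τ` reduces to `h : Δⁿ → Δ` with boundary value `1`. Write
`G = (1 + h) / (1 - h)`, of positive real part. By the Schwarz–Pick lemma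
(`norm_sub_le_gamma_of_re_pos`), the ratio of the values of `G` along two families of points whose
Kobayashi distance tends to `0` tends to `1`. This is how special curves enter.

For real `s ∈ [0, 1)` consider the analytic disk `ζ ↦ ζ x` whose `j`-th component is sped up to
`(ζ + s (1 - ζ)) x_j`. The one-variable Julia–Wolff–Carathéodory theorem
(`exists_angular_residue`) gives `(1 - ζ) G → 2 c s` along it, non-tangentially. Two facts about the
growth rates `c s` matter (`exists_growth_rates`).

* `c 0 > 0`. This is Julia's lemma on the radius `t ↦ t x`: `f` maps it into horocycles at some
  boundary point (`exists_norm_sub_sq_le`), and since the radius is peculiar this point is `τ`.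
* `c 0 ≤ c s`. In half-plane coordinates, translating the `j`-th coordinate by a constant does not
  change the growth rate along the radius, so the half-plane Julia inequality with constant `c 0`
  holds at all points of the translated disks, and these points include those of the sped-up radius.

Let now `σ` be special and restricted and let `ζ` be the image of `σ t` under the left inverse of
`x`. The functions `Q_t(s) = (1 - h(σ t + s (1 - ζ) x_j e_j)) / (1 - ζ)` are holomorphic and
uniformly bounded for small complex `s`, because `σ` is restricted, and for real `s ≥ 0` they tend
to `1 / c s`, because `σ` is special. Bounded families converge together with their derivatives
(`exists_tendsto_deriv`), so `Q_t'(0) = - x_j ∂h/∂z_j` tends to the right derivative of `1 / c` at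
`0`, which is real, at most `0` and independent of `σ`.
-/

namespace Polydisk

open Complex ComplexConjugate Metric

/-! ### The Schwarz–Pick lemma -/

/-- The Möbius automorphism of the disk that sends `a` to `0`. -/
noncomputable def mobius (a w : ℂ) : ℂ := (w - a) / (1 - conj a * w)

lemma gamma_apply {n : ℕ} (z w : Fin n → ℂ) (j : Fin n) : gamma z w j = mobius (z j) (w j) := rfl

lemma one_sub_conj_mul_ne_zero {a w : ℂ} (ha : ‖a‖ < 1) (hw : ‖w‖ < 1) :
    1 - conj a * w ≠ 0 := by
  intro h
  have h1 : ‖conj a * w‖ < 1 := by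
    rw [norm_mul, RCLike.norm_conj]
    nlinarith [norm_nonneg a, norm_nonneg w]
  rw [← sub_eq_zero.mp h] at h1
  simp at h1

lemma normSq_one_sub_conj_mul (a w : ℂ) :
    ‖1 - conj a * w‖ ^ 2 - ‖w - a‖ ^ 2 = (1 - ‖a‖ ^ 2) * (1 - ‖w‖ ^ 2) := by
  simp only [← normSq_eq_norm_sq, normSq_apply, sub_re, sub_im, mul_re, mul_im, conj_re, conj_im,
    one_re, one_im]
  ring

lemma one_sub_norm_mobius_sq {a w : ℂ} (ha : ‖a‖ < 1) (hw : ‖w‖ < 1) :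
    1 - ‖mobius a w‖ ^ 2 = (1 - ‖a‖ ^ 2) * (1 - ‖w‖ ^ 2) / ‖1 - conj a * w‖ ^ 2 := by
  have h : ‖1 - conj a * w‖ ≠ 0 := norm_ne_zero_iff.mpr (one_sub_conj_mul_ne_zero ha hw)
  rw [← normSq_one_sub_conj_mul, mobius, norm_div, div_pow, sub_div, div_self (pow_ne_zero 2 h)]

lemma norm_mobius_lt_one {a w : ℂ} (ha : ‖a‖ < 1) (hw : ‖w‖ < 1) : ‖mobius a w‖ < 1 := by
  have h : 0 < ‖1 - conj a * w‖ := norm_pos_iff.mpr (one_sub_conj_mul_ne_zero ha hw)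
  have h1 : 0 < 1 - ‖mobius a w‖ ^ 2 := by
    rw [one_sub_norm_mobius_sq ha hw]
    have := norm_nonneg a
    have := norm_nonneg w
    have : 0 < 1 - ‖a‖ ^ 2 := by nlinarith
    have : 0 < 1 - ‖w‖ ^ 2 := by nlinarith
    positivity
  nlinarith [norm_nonneg (mobius a w)]

lemma mobius_neg_mobius {a w : ℂ} (ha : ‖a‖ < 1) (hw : ‖w‖ < 1) :
    mobius (-a) (mobius a w) = w := by
  have h := one_sub_conj_mul_ne_zero ha hw
  have h2 : 1 - conj (-a) * mobius a w ≠ 0 :=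
    one_sub_conj_mul_ne_zero (by simpa using ha) (norm_mobius_lt_one ha hw)
  have h3 : mobius a w * (1 - conj a * w) = w - a := div_mul_cancel₀ _ h
  rw [mobius, div_eq_iff h2]
  have h4 : (mobius a w - -a - w * (1 - conj (-a) * mobius a w)) * (1 - conj a * w) = 0 := by
    simp only [map_neg]
    linear_combination (1 - conj a * w) * h3
  exact sub_eq_zero.mp ((mul_eq_zero.mp h4).resolve_right h)

lemma norm_mobius_comm (a w : ℂ) : ‖mobius a w‖ = ‖mobius w a‖ := by
  rw [mobius, mobius, norm_div, norm_div, norm_sub_rev]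
  congr 1
  rw [← RCLike.norm_conj]
  simp [mul_comm]

lemma mobius_neg_zero (a : ℂ) : mobius (-a) 0 = a := by simp [mobius]

lemma norm_apply_lt_one {n : ℕ} {z : Fin n → ℂ} (hz : z ∈ polydisk n) (j : Fin n) : ‖z j‖ < 1 :=
  (norm_le_pi_norm z j).trans_lt (mem_ball_zero_iff.mp hz)

lemma mem_polydisk_iff {n : ℕ} {z : Fin n → ℂ} : z ∈ polydisk n ↔ ∀ j, ‖z j‖ < 1 := by
  rw [polydisk, mem_ball_zero_iff, pi_norm_lt_iff one_pos]

lemma norm_gamma_lt_one {n : ℕ} {z w : Fin n → ℂ} (hz : z ∈ polydisk n) (hw : w ∈ polydisk n) :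
    ‖gamma z w‖ < 1 :=
  (pi_norm_lt_iff one_pos).mpr fun j =>
    norm_mobius_lt_one (norm_apply_lt_one hz j) (norm_apply_lt_one hw j)

lemma norm_gamma_comm {n : ℕ} (z w : Fin n → ℂ) : ‖gamma z w‖ = ‖gamma w z‖ := by
  refine le_antisymm ?_ ?_ <;>
  · refine (pi_norm_le_iff_of_nonneg (norm_nonneg _)).mpr fun j => ?_
    rw [gamma_apply, norm_mobius_comm]
    exact norm_le_pi_norm (gamma _ _) j

/-- The Schwarz lemma for maps of a unit ball into the right half-plane, at the centre. -/
lemma norm_sub_le_of_re_pos_at_zero {E : Type*} [NormedAddCommGroup E] [NormedSpace ℂ E]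
    {F : E → ℂ} (hF : DifferentiableOn ℂ F (ball 0 1)) (hre : ∀ z ∈ ball (0 : E) 1, 0 < (F z).re)
    {z : E} (hz : z ∈ ball (0 : E) 1) :
    ‖F z - F 0‖ ≤ ‖z‖ * ‖F z + conj (F 0)‖ := by
  have h0 : (0 : E) ∈ ball (0 : E) 1 := mem_ball_self one_pos
  have hne : ∀ w ∈ ball (0 : E) 1, F w + conj (F 0) ≠ 0 := fun w hw h => by
    have := congrArg re h
    simp only [add_re, conj_re, zero_re] at this
    linarith [hre w hw, hre 0 h0]
  have hle : ∀ w ∈ ball (0 : E) 1, ‖F w - F 0‖ ≤ ‖F w + conj (F 0)‖ := fun w hw => by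
    refine abs_le_of_sq_le_sq' ?_ (norm_nonneg _) |>.2
    simp only [← normSq_eq_norm_sq, normSq_apply, sub_re, sub_im, add_re, add_im, conj_re, conj_im]
    nlinarith [mul_pos (hre w hw) (hre 0 h0)]
  have key := norm_le_norm_of_mapsTo_ball (R := 1)
    (f := fun w => (F w - F 0) * (F w + conj (F 0))⁻¹)
    ((hF.sub_const _).mul ((hF.add_const _).inv hne))
    (fun w hw => by
      rw [mem_closedBall_zero_iff]
      beta_reduce
      rw [← div_eq_mul_inv, norm_div]
      exact div_le_one_of_le₀ (hle w hw) (norm_nonneg _))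
    (by simp) (mem_ball_zero_iff.mp hz)
  rwa [← div_eq_mul_inv, norm_div, div_le_iff₀ (norm_pos_iff.mpr (hne z hz))] at key

lemma differentiableOn_mobius {a : ℂ} (ha : ‖a‖ < 1) :
    DifferentiableOn ℂ (mobius a) (ball 0 1) :=
  DifferentiableOn.div (by fun_prop) (by fun_prop)
    fun _ hw => one_sub_conj_mul_ne_zero ha (mem_ball_zero_iff.mp hw)

lemma differentiableOn_gamma {n : ℕ} {z : Fin n → ℂ} (hz : z ∈ polydisk n) :
    DifferentiableOn ℂ (gamma z) (ball 0 1) := by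
  refine differentiableOn_pi.mpr fun j => ?_
  exact (differentiableOn_mobius (norm_apply_lt_one hz j)).comp
    (differentiable_apply j).differentiableOn
    fun w hw => mem_ball_zero_iff.mpr (norm_apply_lt_one hw j)

/-- The Schwarz–Pick lemma for maps of the disk into the right half-plane. -/
lemma norm_sub_le_mobius_of_re_pos {F : ℂ → ℂ} (hF : DifferentiableOn ℂ F disk)
    (hre : ∀ ζ ∈ disk, 0 < (F ζ).re) {ζ₀ ζ : ℂ} (hζ₀ : ζ₀ ∈ disk) (hζ : ζ ∈ disk) :
    ‖F ζ - F ζ₀‖ ≤ ‖mobius ζ₀ ζ‖ * ‖F ζ + conj (F ζ₀)‖ := by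
  have h0 : ‖ζ₀‖ < 1 := mem_ball_zero_iff.mp hζ₀
  have h1 : ‖ζ‖ < 1 := mem_ball_zero_iff.mp hζ
  have hmaps : Set.MapsTo (mobius (-ζ₀)) (ball 0 1) disk := fun w hw =>
    mem_ball_zero_iff.mpr
      (norm_mobius_lt_one (by simpa using h0) (mem_ball_zero_iff.mp hw))
  have := norm_sub_le_of_re_pos_at_zero (F := F ∘ mobius (-ζ₀))
    (hF.comp (differentiableOn_mobius (by simpa using h0)) hmaps)
    (fun w hw => hre _ (hmaps hw)) (z := mobius ζ₀ ζ)
    (mem_ball_zero_iff.mpr (norm_mobius_lt_one h0 h1))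
  simpa [mobius_neg_zero, mobius_neg_mobius h0 h1] using this

/-- The Schwarz–Pick lemma for maps of the polydisk into the right half-plane. -/
lemma norm_sub_le_gamma_of_re_pos {n : ℕ} {F : (Fin n → ℂ) → ℂ}
    (hF : DifferentiableOn ℂ F (polydisk n)) (hre : ∀ z ∈ polydisk n, 0 < (F z).re)
    {z w : Fin n → ℂ} (hz : z ∈ polydisk n) (hw : w ∈ polydisk n) :
    ‖F w - F z‖ ≤ ‖gamma z w‖ * ‖F w + conj (F z)‖ := by
  have hz' : -z ∈ polydisk n := by simpa [polydisk] using hz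
  have hmaps : Set.MapsTo (gamma (-z)) (ball 0 1) (polydisk n) := fun v hv =>
    mem_ball_zero_iff.mpr (norm_gamma_lt_one hz' hv)
  have := norm_sub_le_of_re_pos_at_zero (F := F ∘ gamma (-z))
    (hF.comp (differentiableOn_gamma hz') hmaps)
    (fun v hv => hre _ (hmaps hv)) (z := gamma z w)
    (mem_ball_zero_iff.mpr (norm_gamma_lt_one hz hw))
  have e0 : gamma (-z) 0 = z := funext fun j => mobius_neg_zero (z j)
  have e1 : gamma (-z) (gamma z w) = w := funext fun j =>
    mobius_neg_mobius (norm_apply_lt_one hz j) (norm_apply_lt_one hw j)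
  simpa [e0, e1] using this

/-- In the half-plane, points `A` and `B` at small pseudohyperbolic distance `r` have ratio close
to `1`. -/
lemma norm_sub_le_of_norm_sub_le_mul_add_conj {A B : ℂ} {r : ℝ} (hr : 0 ≤ r) (hr1 : r < 1)
    (h : ‖A - B‖ ≤ r * ‖A + conj B‖) : ‖A - B‖ ≤ 2 * r / (1 - r) * ‖B‖ := by
  have h1 : ‖A + conj B‖ ≤ ‖A - B‖ + 2 * ‖B‖ := by
    calc ‖A + conj B‖ = ‖(A - B) + B + conj B‖ := by ring_nf
      _ ≤ ‖A - B‖ + ‖B‖ + ‖conj B‖ := norm_add₃_le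
      _ = _ := by rw [RCLike.norm_conj]; ring
  rw [div_mul_eq_mul_div, le_div_iff₀ (by linarith)]
  nlinarith [mul_le_mul_of_nonneg_left h1 hr]

/-- If two families of points of the polydisk approach each other in the Kobayashi distance, a
map into the right half-plane has the same growth along both. -/
lemma tendsto_mul_of_gamma_tendsto_zero {n : ℕ} {F : (Fin n → ℂ) → ℂ}
    (hF : DifferentiableOn ℂ F (polydisk n)) (hre : ∀ z ∈ polydisk n, 0 < (F z).re)
    {T : Type*} {l : Filter T} {k : T → ℂ} {a b : T → Fin n → ℂ} {L : ℂ}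
    (ha : ∀ᶠ t in l, a t ∈ polydisk n) (hb : ∀ᶠ t in l, b t ∈ polydisk n)
    (hab : Tendsto (fun t => ‖gamma (b t) (a t)‖) l (𝓝 0))
    (hL : Tendsto (fun t => k t * F (b t)) l (𝓝 L)) :
    Tendsto (fun t => k t * F (a t)) l (𝓝 L) := by
  have hdiff : Tendsto (fun t => k t * F (a t) - k t * F (b t)) l (𝓝 0) := by
    have hbd : Tendsto (fun t => 2 * ‖gamma (b t) (a t)‖ / (1 - ‖gamma (b t) (a t)‖)
        * ‖k t * F (b t)‖) l (𝓝 0) := by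
      have h1 := ((hab.const_mul 2).div (hab.const_sub 1) (by norm_num)).mul hL.norm
      simpa using h1
    refine squeeze_zero_norm' ?_ hbd
    filter_upwards [ha, hb] with t hat hbt
    have := norm_sub_le_of_norm_sub_le_mul_add_conj (norm_nonneg _) (norm_gamma_lt_one hbt hat)
      (norm_sub_le_gamma_of_re_pos hF hre hbt hat)
    rw [← mul_sub, norm_mul, norm_mul]
    calc ‖k t‖ * ‖F (a t) - F (b t)‖
        ≤ ‖k t‖ * (2 * ‖gamma (b t) (a t)‖ / (1 - ‖gamma (b t) (a t)‖) * ‖F (b t)‖) := by gcongr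
      _ = _ := by ring
  simpa using hdiff.add hL

/-! ### The Julia–Wolff–Carathéodory theorem for maps of the disk into the right half-plane -/

/-- The Cayley transform `(1 + ζ) / (1 - ζ)` from the disk onto the right half-plane, which sends
`1` to infinity. -/
noncomputable def cayley (ζ : ℂ) : ℂ := (1 + ζ) / (1 - ζ)

lemma norm_lt_one_of_mem_disk {ζ : ℂ} (hζ : ζ ∈ disk) : ‖ζ‖ < 1 := mem_ball_zero_iff.mp hζ

lemma one_sub_ne_zero_of_mem_disk {ζ : ℂ} (hζ : ζ ∈ disk) : 1 - ζ ≠ 0 := fun h => by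
  have := norm_lt_one_of_mem_disk hζ
  rw [← sub_eq_zero.mp h] at this
  simp at this

lemma re_div_eq (a b : ℂ) : (a / b).re = (a * conj b).re / ‖b‖ ^ 2 := by
  rw [div_re, ← normSq_eq_norm_sq, mul_re, conj_re, conj_im]
  ring

lemma cayley_re (ζ : ℂ) : (cayley ζ).re = (1 - ‖ζ‖ ^ 2) / ‖1 - ζ‖ ^ 2 := by
  rw [cayley, re_div_eq]
  congr 1
  simp only [← normSq_eq_norm_sq, normSq_apply, map_sub, map_one, mul_re, add_re, add_im, sub_re,
    sub_im, one_re, one_im, conj_re, conj_im]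
  ring

lemma cayley_re_pos {ζ : ℂ} (hζ : ζ ∈ disk) : 0 < (cayley ζ).re := by
  have h1 : 0 < ‖1 - ζ‖ := norm_pos_iff.mpr (one_sub_ne_zero_of_mem_disk hζ)
  have h2 : 0 < 1 - ‖ζ‖ ^ 2 := by
    nlinarith [norm_nonneg ζ, norm_lt_one_of_mem_disk hζ]
  rw [cayley_re]
  positivity

lemma differentiableOn_cayley : DifferentiableOn ℂ cayley disk :=
  DifferentiableOn.div (by fun_prop) (by fun_prop) fun _ hζ => one_sub_ne_zero_of_mem_disk hζ

/-- Harnack's inequality, in the form of a bound on the modulus once the imaginary part has been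
normalized to vanish at the base point. -/
lemma norm_sub_im_le_of_norm_sub_le_mul_add_conj {A B : ℂ} {r : ℝ} (hr : 0 ≤ r) (hr1 : r < 1)
    (hB : 0 ≤ B.re) (h : ‖A - B‖ ≤ r * ‖A + conj B‖) :
    ‖A - B.im * I‖ ≤ 4 / (1 - r ^ 2) * B.re := by
  have e1 : A - B = (A - B.im * I) - B.re := by
    conv_lhs => rw [← re_add_im B]
    ring
  have e2 : A + conj B = (A - B.im * I) + B.re := by
    apply Complex.ext
    · simp
    · simp [sub_eq_add_neg]
  rw [e1, e2] at h
  have hn : ‖(B.re : ℂ)‖ = B.re := by rw [norm_real, Real.norm_of_nonneg hB]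
  have h1 := norm_sub_norm_le (A - B.im * I) (B.re : ℂ)
  have h2 := norm_add_le (A - B.im * I) (B.re : ℂ)
  rw [hn] at h1 h2
  have h3 : ‖A - B.im * I‖ * (1 - r) ≤ (1 + r) * B.re := by
    nlinarith [mul_le_mul_of_nonneg_left h2 hr]
  rw [div_mul_eq_mul_div, le_div_iff₀ (by nlinarith)]
  nlinarith [mul_le_mul_of_nonneg_left h3 (by linarith : 0 ≤ 1 + r), mul_nonneg hB hr,
    mul_nonneg (mul_nonneg hB hr) (by linarith : 0 ≤ 1 - r)]

/-- The Julia–Wolff–Carathéodory theorem: the largest `c` with `c Re (1 + ζ) / (1 - ζ) ≤ Re g`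
also gives the non-tangential growth of `g` at `1`. -/
lemma exists_angular_residue {g : ℂ → ℂ} (hg : DifferentiableOn ℂ g disk)
    (hre : ∀ ζ ∈ disk, 0 < (g ζ).re) :
    ∃ c : ℝ, (∀ ζ ∈ disk, c * (cayley ζ).re ≤ (g ζ).re) ∧
      ∀ M : ℝ, Tendsto (fun ζ => (1 - ζ) * g ζ) (𝓝[stolz 1 M] 1) (𝓝 (2 * c)) := by
  set S : Set ℝ := (fun ζ => (g ζ).re / (cayley ζ).re) '' disk with hS
  have hSne : S.Nonempty := ⟨_, 0, mem_ball_self one_pos, rfl⟩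
  have hSb : BddBelow S := ⟨0, by
    rintro _ ⟨ζ, hζ, rfl⟩
    exact (div_pos (hre ζ hζ) (cayley_re_pos hζ)).le⟩
  have hc : ∀ ζ ∈ disk, sInf S * (cayley ζ).re ≤ (g ζ).re := fun ζ hζ =>
    (le_div_iff₀ (cayley_re_pos hζ)).mp (csInf_le hSb ⟨ζ, hζ, rfl⟩)
  refine ⟨sInf S, hc, fun M => ?_⟩
  set c := sInf S
  rw [Metric.tendsto_nhds]
  intro ε hε
  -- The error terms below add up to `8 δ |M| + 2 δ` in the limit, which is less than `ε`.
  obtain ⟨δ, hδ, hδε⟩ : ∃ δ : ℝ, 0 < δ ∧ 8 * δ * |M| + 4 * δ = ε :=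
    ⟨ε / (8 * |M| + 4), by positivity, by field_simp⟩
  obtain ⟨_, ⟨ζ₀, hζ₀, rfl⟩, hlt⟩ := exists_lt_of_csInf_lt hSne (lt_add_of_pos_right c hδ)
  have hlt' : (g ζ₀).re < (c + δ) * (cayley ζ₀).re := (div_lt_iff₀ (cayley_re_pos hζ₀)).mp hlt
  -- The function `g - (c - δ) (1 + ζ) / (1 - ζ)` still has positive real part, which is small
  -- at `ζ₀` compared with the real part of the Cayley transform.
  set g₂ : ℂ → ℂ := fun ζ => g ζ - ((c - δ : ℝ) : ℂ) * cayley ζ with hg₂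
  have hg₂d : DifferentiableOn ℂ g₂ disk := hg.sub (differentiableOn_cayley.const_mul _)
  have hg₂re : ∀ ζ, (g₂ ζ).re = (g ζ).re - (c - δ) * (cayley ζ).re := fun ζ => by
    simp only [hg₂, sub_re, re_ofReal_mul]
  have hg₂pos : ∀ ζ ∈ disk, 0 < (g₂ ζ).re := fun ζ hζ => by
    rw [hg₂re]
    nlinarith [hc ζ hζ, mul_pos hδ (cayley_re_pos hζ)]
  set B := g₂ ζ₀
  have hB : B.re ≤ 2 * δ * (cayley ζ₀).re := by
    rw [show B.re = _ from hg₂re ζ₀]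
    nlinarith
  have h0 := norm_lt_one_of_mem_disk hζ₀
  have h01 : 0 < 1 - ‖ζ₀‖ ^ 2 := by nlinarith [norm_nonneg ζ₀]
  have hne0 : 0 < ‖1 - ζ₀‖ := norm_pos_iff.mpr (one_sub_ne_zero_of_mem_disk hζ₀)
  have hbound : ∀ ζ ∈ stolz 1 M, ‖(1 - ζ) * g ζ - 2 * c‖ ≤
      8 * δ * |M| * (‖1 - conj ζ₀ * ζ‖ ^ 2 / ‖1 - ζ₀‖ ^ 2) + ‖1 - ζ‖ * (|B.im| + |c|) + 2 * δ := by
    rintro ζ ⟨hζ, hM⟩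
    have h1 := norm_lt_one_of_mem_disk hζ
    have h11 : 0 < 1 - ‖ζ‖ ^ 2 := by nlinarith [norm_nonneg ζ]
    have hn := one_sub_ne_zero_of_mem_disk hζ
    have hM' : ‖1 - ζ‖ ≤ |M| * (1 - ‖ζ‖ ^ 2) := by
      have h2 : ‖1 - ζ‖ < M * (1 - ‖ζ‖) := (div_lt_iff₀ (by linarith)).mp hM
      have h3 : M * (1 - ‖ζ‖) ≤ |M| * (1 - ‖ζ‖) :=
        mul_le_mul_of_nonneg_right (le_abs_self M) (by linarith)
      have h4 : |M| * (1 - ‖ζ‖) ≤ |M| * (1 - ‖ζ‖ ^ 2) :=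
        mul_le_mul_of_nonneg_left (by nlinarith [norm_nonneg ζ]) (abs_nonneg M)
      linarith
    have hk := norm_sub_im_le_of_norm_sub_le_mul_add_conj (norm_nonneg _)
      (norm_mobius_lt_one h0 h1) (hg₂pos ζ₀ hζ₀).le
      (norm_sub_le_mobius_of_re_pos hg₂d hg₂pos hζ₀ hζ)
    have hden : 0 < ‖1 - conj ζ₀ * ζ‖ := norm_pos_iff.mpr (one_sub_conj_mul_ne_zero h0 h1)
    have hk2 : ‖1 - ζ‖ * ‖g₂ ζ - B.im * I‖ ≤
        8 * δ * |M| * (‖1 - conj ζ₀ * ζ‖ ^ 2 / ‖1 - ζ₀‖ ^ 2) := by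
      rw [one_sub_norm_mobius_sq h0 h1] at hk
      calc ‖1 - ζ‖ * ‖g₂ ζ - B.im * I‖ ≤ (|M| * (1 - ‖ζ‖ ^ 2)) *
            (4 / ((1 - ‖ζ₀‖ ^ 2) * (1 - ‖ζ‖ ^ 2) / ‖1 - conj ζ₀ * ζ‖ ^ 2) *
              (2 * δ * ((1 - ‖ζ₀‖ ^ 2) / ‖1 - ζ₀‖ ^ 2))) := by
            rw [← cayley_re]
            refine mul_le_mul hM' (hk.trans ?_) (norm_nonneg _) (by positivity)
            exact mul_le_mul_of_nonneg_left hB (by positivity)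
        _ = _ := by
            field_simp
            ring
    have hdec : (1 - ζ) * g ζ - 2 * c =
        (1 - ζ) * (g₂ ζ - B.im * I) + (1 - ζ) * (B.im * I - c) + -(δ * (1 + ζ)) := by
      have : (1 - ζ) * cayley ζ = 1 + ζ := mul_div_cancel₀ _ hn
      simp only [hg₂]
      push_cast
      linear_combination ((c : ℂ) - δ) * this
    rw [hdec]
    refine norm_add₃_le.trans (add_le_add_three ?_ ?_ ?_)
    · rwa [norm_mul]
    · rw [norm_mul]
      refine mul_le_mul_of_nonneg_left ((norm_sub_le _ _).trans ?_) (norm_nonneg _)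
      simp
    · rw [norm_neg, norm_mul, norm_real, Real.norm_of_nonneg hδ.le, mul_comm]
      refine mul_le_mul_of_nonneg_right ((norm_add_le _ _).trans ?_) hδ.le
      rw [norm_one]
      linarith
  have hlim : Tendsto (fun ζ : ℂ => 8 * δ * |M| * (‖1 - conj ζ₀ * ζ‖ ^ 2 / ‖1 - ζ₀‖ ^ 2) +
      ‖1 - ζ‖ * (|B.im| + |c|) + 2 * δ) (𝓝[stolz 1 M] 1) (𝓝 (8 * δ * |M| + 2 * δ)) := by
    refine tendsto_nhdsWithin_of_tendsto_nhds ?_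
    have hcont : Continuous (fun ζ : ℂ => 8 * δ * |M| * (‖1 - conj ζ₀ * ζ‖ ^ 2 / ‖1 - ζ₀‖ ^ 2) +
      ‖1 - ζ‖ * (|B.im| + |c|) + 2 * δ) := by fun_prop
    convert hcont.tendsto 1 using 2
    have : ‖1 - conj ζ₀ * 1‖ = ‖1 - ζ₀‖ := by
      rw [← RCLike.norm_conj]
      simp
    rw [this, div_self (by positivity)]
    simp
  filter_upwards [self_mem_nhdsWithin, hlim.eventually (gt_mem_nhds
    (by linarith : 8 * δ * |M| + 2 * δ < ε))] with ζ hζ hlt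
  rw [dist_eq_norm]
  exact (hbound ζ hζ).trans_lt hlt

/-! ### Derivatives of bounded families of holomorphic functions -/

/-- If the `Q t` are holomorphic and uniformly bounded near `0`, and converge at `0` and at all
small positive reals, then their derivatives at `0` converge to the right derivative at `0` of the
limit: the second order Taylor remainders at `0` are bounded uniformly in `t`. -/
lemma exists_tendsto_deriv {T : Type*} {l : Filter T} [l.NeBot] {Q : T → ℂ → ℂ} {δ K : ℝ}
    (hδ : 0 < δ) {A : ℝ → ℂ}
    (hQ : ∀ᶠ t in l, DifferentiableOn ℂ (Q t) (ball 0 δ) ∧ ∀ s ∈ ball (0 : ℂ) δ, ‖Q t s‖ ≤ K)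
    (hA : ∀ s : ℝ, 0 ≤ s → s < δ → Tendsto (fun t => Q t s) l (𝓝 (A s))) :
    ∃ ℓ : ℂ, Tendsto (fun t => deriv (Q t) 0) l (𝓝 ℓ) ∧
      Tendsto (fun s : ℝ => (A s - A 0) / s) (𝓝[>] 0) (𝓝 ℓ) := by
  have h0 : (0 : ℂ) ∈ ball (0 : ℂ) δ := mem_ball_self hδ
  -- The Schwarz lemma to second order, applied to `Q t s - s (Q t)' 0`, which stays within
  -- distance `4 K` of its value at `0`.
  set C : ℝ := 4 * K / δ ^ 2 with hC
  have htaylor : ∀ᶠ t in l, ∀ s : ℝ, 0 < s → s < δ →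
      ‖(Q t s - Q t 0) / s - deriv (Q t) 0‖ ≤ C * s := by
    filter_upwards [hQ] with t ⟨hd, hb⟩ s hs hsδ
    have hderiv : HasDerivAt (Q t) (deriv (Q t) 0) 0 :=
      (hd.differentiableAt (isOpen_ball.mem_nhds h0)).hasDerivAt
    have hDle : ‖deriv (Q t) 0‖ ≤ 2 * K / δ := by
      refine norm_deriv_le_div_of_mapsTo_ball hd (fun w hw => ?_) hδ
      rw [mem_closedBall, dist_eq_norm]
      linarith [norm_sub_le (Q t w) (Q t 0), hb w hw, hb 0 h0]
    have key := dist_le_mul_div_pow_of_mapsTo_ball_of_isLittleO (n := 1) (R₂ := 4 * K) (z := (s : ℂ))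
      (f := fun w => Q t w - w * deriv (Q t) 0) (hd.sub (by fun_prop)) (fun w hw => ?_) ?_
      (by rw [mem_ball_zero_iff, norm_real, Real.norm_of_nonneg hs.le]; exact hsδ)
    · have hs0 : (s : ℂ) ≠ 0 := by exact_mod_cast hs.ne'
      have e : (Q t s - Q t 0) / s - deriv (Q t) 0 =
          ((Q t s - s * deriv (Q t) 0) - (Q t 0 - 0 * deriv (Q t) 0)) / s := by
        field_simp
        ring
      rw [e, norm_div, norm_real, Real.norm_of_nonneg hs.le, div_le_iff₀ hs, ← dist_eq_norm]
      refine key.trans_eq ?_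
      rw [dist_zero_right, norm_real, Real.norm_of_nonneg hs.le, hC, div_pow, one_add_one_eq_two]
      field_simp
    · have hw' : ‖w‖ ≤ δ := (mem_ball_zero_iff.mp hw).le
      rw [mem_closedBall, dist_eq_norm]
      have h1 : ‖w * deriv (Q t) 0‖ ≤ 2 * K := by
        rw [norm_mul]
        calc ‖w‖ * ‖deriv (Q t) 0‖ ≤ δ * (2 * K / δ) := by gcongr
          _ = 2 * K := by field_simp
      calc ‖Q t w - w * deriv (Q t) 0 - (Q t 0 - 0 * deriv (Q t) 0)‖
          = ‖(Q t w - Q t 0) - w * deriv (Q t) 0‖ := by ring_nf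
        _ ≤ ‖Q t w‖ + ‖Q t 0‖ + ‖w * deriv (Q t) 0‖ :=
          (norm_sub_le _ _).trans (by gcongr; exact norm_sub_le _ _)
        _ ≤ 4 * K := by linarith [hb w hw, hb 0 h0]
    · have := hasDerivAt_iff_isLittleO.mp hderiv
      simp only [pow_one]
      refine (this.congr_left fun w => ?_).norm_right
      simp only [smul_eq_mul]
      ring
  have hslope : ∀ s : ℝ, 0 < s → s < δ →
      Tendsto (fun t => (Q t s - Q t 0) / s) l (𝓝 ((A s - A 0) / s)) := fun s hs hsδ =>
    ((hA s hs.le hsδ).sub (by simpa using hA 0 le_rfl hδ)).div_const _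
  have hCs : Tendsto (fun s : ℝ => C * s) (𝓝[>] 0) (𝓝 0) :=
    tendsto_nhdsWithin_of_tendsto_nhds (Continuous.tendsto' (by fun_prop) _ _ (by simp))
  obtain ⟨ℓ, hℓ⟩ : ∃ ℓ, Tendsto (fun t => deriv (Q t) 0) l (𝓝 ℓ) := by
    refine cauchy_map_iff_exists_tendsto.mp (Metric.cauchy_iff.mpr ⟨inferInstance, fun ε hε => ?_⟩)
    obtain ⟨s, hsC, hs, hsδ⟩ := ((hCs.eventually (gt_mem_nhds (by positivity : 0 < ε / 4))).and
      (Ioo_mem_nhdsGT hδ)).exists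
    refine ⟨ball ((A s - A 0) / s) (ε / 2), ?_, fun a ha b hb => ?_⟩
    · rw [mem_map]
      filter_upwards [htaylor, Metric.tendsto_nhds.mp (hslope s hs hsδ) (ε / 4) (by positivity)]
        with t h1 h2
      have h3 := h1 s hs hsδ
      rw [← dist_eq_norm, dist_comm] at h3
      rw [Set.mem_preimage, mem_ball]
      linarith [dist_triangle (deriv (Q t) 0) ((Q t s - Q t 0) / s) ((A s - A 0) / s)]
    · linarith [dist_triangle_right a b ((A s - A 0) / (s : ℂ)), mem_ball.mp ha, mem_ball.mp hb]
  refine ⟨ℓ, hℓ, ?_⟩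
  rw [tendsto_iff_norm_sub_tendsto_zero]
  refine squeeze_zero' (Eventually.of_forall fun _ => norm_nonneg _) ?_ hCs
  filter_upwards [Ioo_mem_nhdsGT hδ] with s ⟨hs, hsδ⟩
  exact le_of_tendsto ((hslope s hs hsδ).sub hℓ).norm (htaylor.mono fun t ht => ht s hs hsδ)

/-! ### The radius ending at a boundary point of the polydisk -/

section

variable {n : ℕ} {x : Fin n → ℂ}

lemma norm_eq_one_of_mem_frontier (hx : x ∈ frontier (polydisk n)) : ‖x‖ = 1 :=
  mem_sphere_zero_iff_norm.mp (frontier_ball_subset_sphere hx)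

lemma smul_mem_polydisk (hx : ‖x‖ = 1) {ζ : ℂ} (hζ : ζ ∈ disk) : ζ • x ∈ polydisk n := by
  rw [polydisk, mem_ball_zero_iff, norm_smul, hx, mul_one]
  exact norm_lt_one_of_mem_disk hζ

lemma ofReal_mem_disk {t : ℝ} (ht : t ∈ Set.Ico (0 : ℝ) 1) : (t : ℂ) ∈ disk := by
  rw [disk, mem_ball_zero_iff, norm_real, Real.norm_of_nonneg ht.1]
  exact ht.2

lemma leftInv_self {j : Fin n} (hj : IsSilovComponent x j) : leftInv x x = 1 := by
  have h1 : ∀ i, x i * conj (silovPart x i) = if ‖x i‖ = 1 then 1 else 0 := fun i => by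
    unfold silovPart
    split_ifs with h
    · rw [mul_conj, normSq_eq_norm_sq, h]
      simp
    · simp
  have h2 : (silovDegree x : ℂ) ≠ 0 := by
    rw [Nat.cast_ne_zero]
    exact (Finset.card_pos.mpr ⟨j, Finset.mem_filter.mpr ⟨Finset.mem_univ j, show ‖x j‖ = 1 from hj⟩⟩).ne'
  rw [leftInv, Finset.sum_congr rfl fun i _ => h1 i, Finset.sum_boole]
  exact one_div_mul_cancel h2

lemma leftInv_smul (ζ : ℂ) (z : Fin n → ℂ) : leftInv x (ζ • z) = ζ * leftInv x z := by
  simp only [leftInv, Pi.smul_apply, smul_eq_mul, mul_assoc, ← Finset.mul_sum]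
  ring

lemma continuous_leftInv : Continuous (leftInv x) := by
  unfold leftInv
  fun_prop

/-- The horosphere estimate on the radius: near `x`, only the Šilov components matter. -/
lemma eventually_one_sub_norm_sq_le (hx : ‖x‖ = 1) {t : ℝ} (ht : t ∈ Set.Ico (0 : ℝ) 1) :
    ∀ᶠ w in 𝓝[polydisk n] x,
      1 - ‖w‖ ^ 2 ≤ 2 * (1 - t) * (1 - ‖gamma ((t : ℂ) • x) w‖ ^ 2) := by
  obtain ⟨ht0, ht1⟩ := ht
  have hxj : ∀ j, ‖x j‖ ≤ 1 := fun j => (norm_le_pi_norm x j).trans_eq hx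
  have hcomp : ∀ j, ∀ᶠ w in 𝓝[polydisk n] x,
      (1 - ‖w‖ ^ 2) * ‖1 - conj ((t : ℂ) * x j) * w j‖ ^ 2 ≤
        2 * (1 - t) * ((1 - ‖(t : ℂ) * x j‖ ^ 2) * (1 - ‖w j‖ ^ 2)) := by
    intro j
    have hn : ‖(t : ℂ) * x j‖ = t * ‖x j‖ := by
      rw [norm_mul, norm_real, Real.norm_of_nonneg ht0]
    rw [hn]
    rcases (hxj j).lt_or_eq with hlt | heq
    · refine Filter.Eventually.filter_mono nhdsWithin_le_nhds ?_
      refine (ContinuousAt.eventually_lt (f := fun w : Fin n → ℂ =>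
        (1 - ‖w‖ ^ 2) * ‖1 - conj ((t : ℂ) * x j) * w j‖ ^ 2) (Continuous.continuousAt (by fun_prop))
          (Continuous.continuousAt (by fun_prop)) ?_).mono
        fun w hw => hw.le
      rw [hx]
      have h1 : 0 < 1 - ‖x j‖ ^ 2 := by nlinarith [norm_nonneg (x j)]
      have h2 : 0 < 1 - (t * ‖x j‖) ^ 2 := by
        have : t * ‖x j‖ < 1 := by nlinarith [norm_nonneg (x j)]
        nlinarith [mul_nonneg ht0 (norm_nonneg (x j))]
      have h3 : 0 < 1 - t := by linarith
      norm_num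
      positivity
    · have hev : ∀ᶠ w in 𝓝[polydisk n] x,
          ‖1 - conj ((t : ℂ) * x j) * w j‖ ^ 2 < 2 * (1 - t) * (1 - t ^ 2) := by
        refine Filter.Eventually.filter_mono nhdsWithin_le_nhds ?_
        refine ContinuousAt.eventually_lt (f := fun w : Fin n → ℂ =>
          ‖1 - conj ((t : ℂ) * x j) * w j‖ ^ 2) (Continuous.continuousAt (by fun_prop))
          (Continuous.continuousAt (by fun_prop)) ?_
        have : 1 - conj ((t : ℂ) * x j) * x j = ((1 - t : ℝ) : ℂ) := by
          rw [map_mul, conj_ofReal, mul_assoc, mul_comm (conj (x j)), mul_conj, normSq_eq_norm_sq,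
            heq]
          push_cast
          ring
        rw [this, norm_real, Real.norm_of_nonneg (by linarith)]
        nlinarith [mul_pos (sub_pos.mpr ht1) (sub_pos.mpr ht1),
          mul_nonneg (mul_pos (sub_pos.mpr ht1) (sub_pos.mpr ht1)).le ht0]
      filter_upwards [hev, self_mem_nhdsWithin] with w hw hwp
      have hwj : 1 - ‖w‖ ^ 2 ≤ 1 - ‖w j‖ ^ 2 := by
        have := norm_le_pi_norm w j
        have := norm_nonneg (w j)
        nlinarith
      have hwj0 : 0 ≤ 1 - ‖w j‖ ^ 2 := by
        have := norm_apply_lt_one hwp j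
        have := norm_nonneg (w j)
        nlinarith
      rw [heq, mul_one]
      calc _ ≤ (1 - ‖w j‖ ^ 2) * (2 * (1 - t) * (1 - t ^ 2)) :=
            mul_le_mul hwj hw.le (by positivity) hwj0
        _ = _ := by ring
  have htx : (t : ℂ) • x ∈ polydisk n := smul_mem_polydisk hx (ofReal_mem_disk ⟨ht0, ht1⟩)
  have hpos : 0 < 2 * (1 - t) := by linarith
  filter_upwards [eventually_all.mpr hcomp, self_mem_nhdsWithin] with w hw hwp
  have hj : ∀ j, ‖gamma ((t : ℂ) • x) w j‖ ^ 2 ≤ 1 - (1 - ‖w‖ ^ 2) / (2 * (1 - t)) := fun j => by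
    have h1 := norm_apply_lt_one htx j
    have h2 := norm_apply_lt_one hwp j
    have h3 : 0 < ‖1 - conj (((t : ℂ) • x) j) * w j‖ :=
      norm_pos_iff.mpr (one_sub_conj_mul_ne_zero h1 h2)
    have h4 := one_sub_norm_mobius_sq h1 h2
    rw [← gamma_apply] at h4
    suffices (1 - ‖w‖ ^ 2) / (2 * (1 - t)) ≤ 1 - ‖gamma ((t : ℂ) • x) w j‖ ^ 2 by linarith
    rw [h4, div_le_div_iff₀ hpos (by positivity), mul_comm (_ * _) (2 * (1 - t))]
    exact hw j
  have hn : Nonempty (Fin n) := by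
    by_contra h
    rw [not_nonempty_iff] at h
    simp [Subsingleton.elim x 0] at hx
  obtain ⟨j₀⟩ := hn
  have hR := (sq_nonneg _).trans (hj j₀)
  have hle : ‖gamma ((t : ℂ) • x) w‖ ≤ Real.sqrt (1 - (1 - ‖w‖ ^ 2) / (2 * (1 - t))) :=
    (pi_norm_le_iff_of_nonneg (Real.sqrt_nonneg _)).mpr fun j => Real.le_sqrt_of_sq_le (hj j)
  have hsq := pow_le_pow_left₀ (norm_nonneg _) hle 2
  rw [Real.sq_sqrt hR] at hsq
  have : (1 - ‖w‖ ^ 2) / (2 * (1 - t)) ≤ 1 - ‖gamma ((t : ℂ) • x) w‖ ^ 2 := by linarith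
  rw [div_le_iff₀ hpos] at this
  linarith

lemma gamma_zero (w : Fin n → ℂ) : gamma 0 w = w := by
  ext j
  simp [gamma]

lemma isCurveTo_radius (hx : ‖x‖ = 1) : IsCurveTo x (fun t : ℝ => (t : ℂ) • x) where
  continuousOn := by fun_prop
  mapsTo := fun _ ht => smul_mem_polydisk hx (ofReal_mem_disk ht)
  tendsto := tendsto_nhdsWithin_of_tendsto_nhds
    (Continuous.tendsto' (by fun_prop) _ _ (by simp))

lemma eventually_mem_Ico : ∀ᶠ t in 𝓝[<] (1 : ℝ), t ∈ Set.Ico (0 : ℝ) 1 :=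
  Ico_mem_nhdsLT one_pos

lemma isPeculiar_radius (hx : ‖x‖ = 1) : IsPeculiar x (fun t : ℝ => (t : ℂ) • x) := by
  intro R hR
  have h1 : ∀ᶠ t in 𝓝[<] (1 : ℝ), 8 * (1 - t) < R := by
    have : Tendsto (fun t : ℝ => 8 * (1 - t)) (𝓝[<] 1) (𝓝 0) :=
      tendsto_nhdsWithin_of_tendsto_nhds (Continuous.tendsto' (by fun_prop) _ _ (by simp))
    exact this.eventually (gt_mem_nhds hR)
  filter_upwards [h1, eventually_mem_Ico] with t htR ht
  have htx := smul_mem_polydisk hx (ofReal_mem_disk ht)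
  have ht1 : 0 < 1 - t := by linarith [ht.2]
  refine ⟨htx, lt_of_le_of_lt (limsup_le_of_le
    (h := (?_ : ∀ᶠ w in 𝓝[polydisk n] x, _ ≤ (((1 / 2) * Real.log (8 * (1 - t)) : ℝ) : EReal)))) ?_⟩
  · filter_upwards [eventually_one_sub_norm_sq_le hx ht, self_mem_nhdsWithin] with w hw hwp
    rw [EReal.coe_le_coe_iff, kobayashiDist, kobayashiDist, gamma_zero]
    set r := ‖gamma ((t : ℂ) • x) w‖
    have hr0 : 0 ≤ r := norm_nonneg _
    have hr1 : r < 1 := norm_gamma_lt_one htx hwp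
    have hw0 : 0 ≤ ‖w‖ := norm_nonneg _
    have hw1 : ‖w‖ < 1 := mem_ball_zero_iff.mp hwp
    have hq : 0 < (1 + ‖w‖) / (1 - ‖w‖) := div_pos (by linarith) (by linarith)
    have key : (1 + r) / (1 - r) ≤ 8 * (1 - t) * ((1 + ‖w‖) / (1 - ‖w‖)) := by
      rw [← mul_div_assoc, div_le_div_iff₀ (by linarith) (by linarith)]
      have e1 : (1 + r) * (1 - ‖w‖) ≤ (1 + r) * ((1 - ‖w‖ ^ 2)) :=
        mul_le_mul_of_nonneg_left (by nlinarith) (by linarith)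
      have e2 : (1 + r) * ((1 - ‖w‖ ^ 2)) ≤ (1 + r) * (2 * (1 - t) * (1 - r ^ 2)) :=
        mul_le_mul_of_nonneg_left hw (by linarith)
      have e3 : 0 ≤ (1 - t) * (1 - r) := mul_nonneg ht1.le (by linarith)
      have e4 : (1 + r) * (2 * (1 - t) * (1 - r ^ 2)) ≤ 8 * ((1 - t) * (1 - r)) := by
        have : (1 + r) ^ 2 ≤ 4 := by nlinarith
        nlinarith [mul_le_mul_of_nonneg_left this e3]
      nlinarith [mul_nonneg e3 hw0]
    have hlog := Real.log_le_log (div_pos (by linarith) (by linarith)) key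
    rw [Real.log_mul (by positivity) hq.ne'] at hlog
    linarith
  · rw [EReal.coe_lt_coe_iff]
    have := Real.log_lt_log (by linarith) htR
    linarith

lemma isSpecial_radius {j : Fin n} (hj : IsSilovComponent x j) :
    IsSpecial x (fun t : ℝ => (t : ℂ) • x) := by
  have hz : ∀ z : Fin n → ℂ, kobayashiDist z z = 0 := fun z => by
    have : gamma z z = 0 := by
      ext i
      simp [gamma]
    simp [kobayashiDist, this]
  simp only [IsSpecial, retraction, leftInv_smul, leftInv_self hj, mul_one, hz]
  exact tendsto_const_nhds

lemma isRestricted_radius {j : Fin n} (hj : IsSilovComponent x j) :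
    IsRestricted x (fun t : ℝ => (t : ℂ) • x) := by
  refine ⟨2, one_lt_two, ?_⟩
  filter_upwards [eventually_mem_Ico] with t ht
  rw [leftInv_smul, leftInv_self hj, mul_one]
  refine ⟨ofReal_mem_disk ht, ?_⟩
  have h1 : 0 < 1 - t := by linarith [ht.2]
  rw [norm_real, Real.norm_of_nonneg ht.1, ← ofReal_one, ← ofReal_sub, norm_real,
    Real.norm_of_nonneg h1.le, div_self h1.ne']
  exact one_lt_two

end

/-! ### Julia's lemma along the radius -/

section

variable {n : ℕ} {x : Fin n → ℂ} {f : (Fin n → ℂ) → ℂ}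

lemma differentiableOn_cayley_comp (hf : IsHol f) :
    DifferentiableOn ℂ (fun z => cayley (f z)) (polydisk n) :=
  differentiableOn_cayley.comp hf.differentiableOn hf.mapsTo

/-- The Schwarz–Pick lemma for maps of the polydisk into the disk. -/
lemma norm_mobius_le_norm_gamma (hf : IsHol f) {z w : Fin n → ℂ} (hz : z ∈ polydisk n)
    (hw : w ∈ polydisk n) : ‖mobius (f z) (f w)‖ ≤ ‖gamma z w‖ := by
  have key := norm_sub_le_gamma_of_re_pos (differentiableOn_cayley_comp hf)
    (fun v hv => cayley_re_pos (hf.mapsTo hv)) hz hw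
  have hz1 := one_sub_ne_zero_of_mem_disk (hf.mapsTo hz)
  have hw1 := one_sub_ne_zero_of_mem_disk (hf.mapsTo hw)
  have hz2 : conj (1 - f z) ≠ 0 := (map_ne_zero _).mpr hz1
  have hzc : 1 - conj (f z) ≠ 0 := by simpa using hz2
  have hzw := norm_pos_iff.mpr (one_sub_conj_mul_ne_zero
    (norm_lt_one_of_mem_disk (hf.mapsTo hz)) (norm_lt_one_of_mem_disk (hf.mapsTo hw)))
  have e1 : cayley (f w) - cayley (f z) = 2 * (f w - f z) / ((1 - f w) * (1 - f z)) := by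
    simp only [cayley]
    field_simp
    ring
  have e2 : cayley (f w) + conj (cayley (f z)) =
      2 * (1 - conj (f z) * f w) / ((1 - f w) * conj (1 - f z)) := by
    simp only [cayley, map_div₀, map_add, map_sub, map_one]
    field_simp
    ring
  rw [e1, e2, norm_div, norm_div, norm_mul, norm_mul, norm_mul, norm_mul, RCLike.norm_conj] at key
  have hd : 0 < ‖1 - f w‖ * ‖1 - f z‖ :=
    mul_pos (norm_pos_iff.mpr hw1) (norm_pos_iff.mpr hz1)
  rw [← mul_div_assoc, div_le_div_iff_of_pos_right hd, RCLike.norm_ofNat] at key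
  rw [mobius, norm_div, div_le_iff₀ hzw]
  linarith

/-- Points `w → x` that realize the lower limit in the definition of an `α`-Julia function. -/
lemma frequently_one_sub_norm_sq_le (hf : IsHol f) {α : ℝ} (hα : IsJulia α f x) :
    ∃ᶠ w in 𝓝[polydisk n] x, w ∈ polydisk n ∧ 1 - ‖f w‖ ^ 2 ≤ 8 * α * (1 - ‖w‖ ^ 2) := by
  obtain ⟨hα0, hlim⟩ := hα
  have hlt : liminf (fun w => ((kobayashiDist 0 w - poincareDist 0 (f w) : ℝ) : EReal))
      (𝓝[polydisk n] x) < (((1 / 2) * Real.log (2 * α) : ℝ) : EReal) := by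
    rw [hlim, EReal.coe_lt_coe_iff]
    have := Real.log_lt_log hα0 (by linarith : α < 2 * α)
    linarith
  have hfreq := frequently_lt_of_liminf_lt (by isBoundedDefault) hlt
  refine (hfreq.and_eventually self_mem_nhdsWithin).mono fun w ⟨hw, hwp⟩ => ⟨hwp, ?_⟩
  rw [EReal.coe_lt_coe_iff, kobayashiDist, poincareDist, gamma_zero] at hw
  simp only [sub_zero, map_zero, zero_mul, div_one] at hw
  have hw0 : 0 ≤ ‖w‖ := norm_nonneg _
  have hw1 : ‖w‖ < 1 := mem_ball_zero_iff.mp hwp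
  have hf0 : 0 ≤ ‖f w‖ := norm_nonneg _
  have hf1 := norm_lt_one_of_mem_disk (hf.mapsTo hwp)
  have hq : 0 < (1 + ‖f w‖) / (1 - ‖f w‖) := div_pos (by linarith) (by linarith)
  have hlog : Real.log ((1 + ‖w‖) / (1 - ‖w‖)) <
      Real.log (2 * α * ((1 + ‖f w‖) / (1 - ‖f w‖))) := by
    rw [Real.log_mul (by positivity) hq.ne']
    linarith
  have h1 := (Real.log_lt_log_iff (div_pos (by linarith) (by linarith)) (by positivity)).mp hlog
  rw [← mul_div_assoc, div_lt_div_iff₀ (by linarith) (by linarith)] at h1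
  have h2 : 0 ≤ α * (1 - ‖w‖) := mul_nonneg hα0.le (by linarith)
  nlinarith [mul_nonneg h2 hw0, mul_nonneg h2 (by linarith : 0 ≤ 1 - ‖f w‖),
    mul_nonneg hw0 (by linarith : 0 ≤ 1 - ‖f w‖)]

/-- Julia's lemma on the radius: `f` maps it into horocycles at some boundary point. -/
lemma exists_norm_sub_sq_le (hx : ‖x‖ = 1) (hf : IsHol f) {α : ℝ} (hα : IsJulia α f x) :
    ∃ τ : ℂ, ∀ t ∈ Set.Ico (0 : ℝ) 1, ‖τ - f ((t : ℂ) • x)‖ ^ 2 ≤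
      16 * α * (1 - t) * (1 - ‖f ((t : ℂ) • x)‖ ^ 2) := by
  have hα0 := hα.1
  -- An ultrafilter converging to `x` along points realizing the lower limit.
  have hne := frequently_iff_neBot.mp (frequently_one_sub_norm_sq_le hf hα)
  set 𝓤 := Ultrafilter.of
    (𝓝[polydisk n] x ⊓ 𝓟 {w | w ∈ polydisk n ∧ 1 - ‖f w‖ ^ 2 ≤ 8 * α * (1 - ‖w‖ ^ 2)})
  have hle := Ultrafilter.of_le
    (𝓝[polydisk n] x ⊓ 𝓟 {w | w ∈ polydisk n ∧ 1 - ‖f w‖ ^ 2 ≤ 8 * α * (1 - ‖w‖ ^ 2)})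
  have hlex : (𝓤 : Filter (Fin n → ℂ)) ≤ 𝓝[polydisk n] x := hle.trans inf_le_left
  have hmem : ∀ᶠ w in (𝓤 : Filter (Fin n → ℂ)),
      w ∈ polydisk n ∧ 1 - ‖f w‖ ^ 2 ≤ 8 * α * (1 - ‖w‖ ^ 2) :=
    (hle.trans inf_le_right) (mem_principal_self _)
  obtain ⟨τ, -, hτ⟩ := (isCompact_closedBall (0 : ℂ) 1).ultrafilter_le_nhds (𝓤.map f) (by
    rw [le_principal_iff]
    exact hmem.mono fun w hw =>
      mem_closedBall_zero_iff.mpr (norm_lt_one_of_mem_disk (hf.mapsTo hw.1)).le)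
  have hτ' : Tendsto f 𝓤 (𝓝 τ) := hτ
  have hid : Tendsto (fun w : Fin n → ℂ => ‖w‖) 𝓤 (𝓝 1) := by
    rw [← hx]
    exact (continuous_norm.tendsto x).mono_left (hlex.trans nhdsWithin_le_nhds)
  have hτn : ‖τ‖ = 1 := by
    refine le_antisymm (le_of_tendsto hτ'.norm
      (hmem.mono fun w hw => (norm_lt_one_of_mem_disk (hf.mapsTo hw.1)).le)) ?_
    have h1 : 1 - ‖τ‖ ^ 2 ≤ 8 * α * (1 - 1 ^ 2) :=
      le_of_tendsto_of_tendsto ((hτ'.norm.pow 2).const_sub 1)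
        (((hid.pow 2).const_sub 1).const_mul _) (hmem.mono fun w hw => hw.2)
    nlinarith [norm_nonneg τ]
  refine ⟨τ, fun t ht => ?_⟩
  have htx := smul_mem_polydisk hx (ofReal_mem_disk ht)
  have ht1 : 0 < 1 - t := by linarith [ht.2]
  set z := (t : ℂ) • x
  have hfz := norm_lt_one_of_mem_disk (hf.mapsTo htx)
  have hfz' : 0 < 1 - ‖f z‖ ^ 2 := by nlinarith [norm_nonneg (f z)]
  have e : ‖τ - f z‖ = ‖1 - conj (f z) * τ‖ := by
    have : 1 - conj (f z) * τ = conj (τ - f z) * τ := by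
      rw [map_sub, sub_mul, mul_comm (conj τ), mul_conj, normSq_eq_norm_sq, hτn]
      simp
    rw [this, norm_mul, RCLike.norm_conj, hτn, mul_one]
  rw [e]
  refine le_of_tendsto ((hτ'.const_mul (conj (f z))).const_sub 1 |>.norm.pow 2) ?_
  filter_upwards [hmem, hlex (eventually_one_sub_norm_sq_le hx ht)] with w ⟨hwp, hw⟩ hw'
  have hfw := norm_lt_one_of_mem_disk (hf.mapsTo hwp)
  have hw1 : ‖w‖ < 1 := mem_ball_zero_iff.mp hwp
  have hw2 : 0 < 1 - ‖w‖ ^ 2 := by nlinarith [norm_nonneg w]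
  have hsp := pow_le_pow_left₀ (norm_nonneg _) (norm_mobius_le_norm_gamma hf htx hwp) 2
  have hid := one_sub_norm_mobius_sq hfz hfw
  have hden : 0 < ‖1 - conj (f z) * f w‖ ^ 2 :=
    pow_pos (norm_pos_iff.mpr (one_sub_conj_mul_ne_zero hfz hfw)) 2
  have h1 : 1 - ‖w‖ ^ 2 ≤ 2 * (1 - t) *
      ((1 - ‖f z‖ ^ 2) * (1 - ‖f w‖ ^ 2) / ‖1 - conj (f z) * f w‖ ^ 2) := by
    rw [← hid]
    exact hw'.trans (mul_le_mul_of_nonneg_left (by linarith) (by linarith))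
  rw [← mul_div_assoc, le_div_iff₀ hden] at h1
  have h2 : 2 * (1 - t) * ((1 - ‖f z‖ ^ 2) * (1 - ‖f w‖ ^ 2)) ≤
      2 * (1 - t) * ((1 - ‖f z‖ ^ 2) * (8 * α * (1 - ‖w‖ ^ 2))) := by gcongr
  refine le_of_mul_le_mul_left ?_ hw2
  linarith

/-- On the radius, the restricted `E`-limit is the boundary point of Julia's lemma. -/
lemma norm_sub_sq_le_of_hasRestrictedELimit (hx : ‖x‖ = 1) (hf : IsHol f) {α : ℝ}
    (hα : IsJulia α f x) {τ : ℂ} (hE : HasRestrictedELimit f x τ) :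
    ∀ t ∈ Set.Ico (0 : ℝ) 1, ‖τ - f ((t : ℂ) • x)‖ ^ 2 ≤
      16 * α * (1 - t) * (1 - ‖f ((t : ℂ) • x)‖ ^ 2) := by
  have hα0 := hα.1
  obtain ⟨τ', hτ'⟩ := exists_norm_sub_sq_le hx hf hα
  have h1 := hE _ (isCurveTo_radius hx) (isPeculiar_radius hx)
  have h2 : ‖τ' - τ‖ ^ 2 ≤ 16 * α * (1 - 1) := by
    have hl : Tendsto (fun t : ℝ => 16 * α * (1 - t)) (𝓝[<] 1) (𝓝 (16 * α * (1 - 1))) :=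
      tendsto_nhdsWithin_of_tendsto_nhds (Continuous.tendsto (by fun_prop) 1)
    refine le_of_tendsto_of_tendsto ((h1.const_sub τ').norm.pow 2) hl ?_
    filter_upwards [eventually_mem_Ico] with t ht
    have h3 : 0 ≤ 16 * α * (1 - t) := mul_nonneg (by linarith) (by linarith [ht.2])
    nlinarith [hτ' t ht, mul_nonneg h3 (sq_nonneg ‖f ((t : ℂ) • x)‖)]
  have h4 : ‖τ' - τ‖ = 0 := by
    rw [sub_self, mul_zero] at h2
    exact pow_eq_zero_iff two_ne_zero |>.mp (le_antisymm h2 (sq_nonneg _))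
  rwa [sub_eq_zero.mp (norm_eq_zero.mp h4)] at hτ'

end

/-! ### Growth along curves of different speed in one Šilov component -/

lemma tendsto_ofReal_stolz {M : ℝ} (hM : 1 < M) :
    Tendsto (fun t : ℝ => (t : ℂ)) (𝓝[<] 1) (𝓝[stolz 1 M] 1) := by
  refine tendsto_nhdsWithin_iff.mpr ⟨tendsto_nhdsWithin_of_tendsto_nhds
    (Continuous.tendsto' (by fun_prop) _ _ (by simp)), ?_⟩
  filter_upwards [eventually_mem_Ico] with t ht
  refine ⟨ofReal_mem_disk ht, ?_⟩
  have h1 : 0 < 1 - t := by linarith [ht.2]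
  rwa [norm_real, Real.norm_of_nonneg ht.1, ← ofReal_one, ← ofReal_sub, norm_real,
    Real.norm_of_nonneg h1.le, div_self h1.ne']

/-- The point `ζ x` with its `j`-th component `ζ x_j` replaced by `μ x_j`. -/
noncomputable def bend {n : ℕ} (x : Fin n → ℂ) (j : Fin n) (ζ μ : ℂ) : Fin n → ℂ :=
  Function.update (ζ • x) j (μ * x j)

lemma norm_mobius_mul_mul {c : ℂ} (hc : ‖c‖ = 1) (a w : ℂ) :
    ‖mobius (a * c) (w * c)‖ = ‖mobius a w‖ := by
  have h : conj c * c = 1 := by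
    rw [mul_comm, mul_conj, normSq_eq_norm_sq, hc]
    simp
  have e : conj (a * c) * (w * c) = conj a * w := by
    rw [map_mul]
    linear_combination conj a * w * h
  rw [mobius, mobius, e, ← sub_mul, norm_div, norm_mul, hc, mul_one, norm_div]

section

variable {n : ℕ} {x : Fin n → ℂ} {j : Fin n} {h : (Fin n → ℂ) → ℂ}

@[simp] lemma bend_same (ζ μ : ℂ) : bend x j ζ μ j = μ * x j := by simp [bend]

lemma bend_of_ne {i : Fin n} (hi : i ≠ j) (ζ μ : ℂ) : bend x j ζ μ i = ζ * x i := by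
  simp [bend, hi]

lemma bend_self (ζ : ℂ) : bend x j ζ ζ = ζ • x := by
  ext i
  by_cases hi : i = j
  · subst hi
    simp
  · simp [bend_of_ne hi]

lemma bend_mem_polydisk (hx : ‖x‖ = 1) {ζ μ : ℂ} (hζ : ζ ∈ disk) (hμ : μ ∈ disk) :
    bend x j ζ μ ∈ polydisk n := by
  refine mem_polydisk_iff.mpr fun i => ?_
  by_cases hi : i = j
  · subst hi
    rw [bend_same]
    exact norm_apply_lt_one (smul_mem_polydisk hx hμ) i
  · rw [bend_of_ne hi]
    exact norm_apply_lt_one (smul_mem_polydisk hx hζ) i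

lemma norm_gamma_smul_bend_le (hj : IsSilovComponent x j) (ζ μ : ℂ) :
    ‖gamma (ζ • x) (bend x j ζ μ)‖ ≤ ‖mobius ζ μ‖ := by
  refine (pi_norm_le_iff_of_nonneg (norm_nonneg _)).mpr fun i => ?_
  rw [gamma_apply]
  by_cases hi : i = j
  · subst hi
    rw [bend_same]
    exact (norm_mobius_mul_mul hj ζ μ).le
  · rw [bend_of_ne hi]
    simp only [Pi.smul_apply, smul_eq_mul, mobius, sub_self, zero_div, norm_zero]
    exact norm_nonneg _

lemma differentiable_bend : Differentiable ℂ (fun p : ℂ × ℂ => bend x j p.1 p.2) := by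
  refine differentiable_pi.mpr fun i => ?_
  by_cases hi : i = j
  · subst hi
    simp only [bend_same]
    fun_prop
  · simp only [bend_of_ne hi]
    fun_prop

/-- The angular residue along a curve that bends the `j`-th component by a self-map `m`. -/
lemma exists_angular_residue_bend (hx : ‖x‖ = 1) (hh : IsHol h) (j : Fin n) {m : ℂ → ℂ}
    (hm : DifferentiableOn ℂ m disk) (hmaps : Set.MapsTo m disk disk) :
    ∃ c : ℝ, (∀ ζ ∈ disk, c * (cayley ζ).re ≤ (cayley (h (bend x j ζ (m ζ)))).re) ∧
      ∀ M : ℝ, Tendsto (fun ζ => (1 - ζ) * cayley (h (bend x j ζ (m ζ))))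
        (𝓝[stolz 1 M] 1) (𝓝 (2 * c)) := by
  have hb : Set.MapsTo (fun ζ => bend x j ζ (m ζ)) disk (polydisk n) := fun ζ hζ =>
    bend_mem_polydisk hx hζ (hmaps hζ)
  refine exists_angular_residue (g := fun ζ => cayley (h (bend x j ζ (m ζ)))) ?_
    fun ζ hζ => cayley_re_pos (hh.mapsTo (hb hζ))
  exact (differentiableOn_cayley_comp hh).comp
    (differentiable_bend.comp_differentiableOn (differentiableOn_id.prodMk hm)) hb

lemma re_one_sub_pos {ζ : ℂ} (hζ : ζ ∈ disk) : 0 < (1 - ζ).re := by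
  rw [sub_re, one_re]
  linarith [re_le_norm ζ, norm_lt_one_of_mem_disk hζ]

/-- The parabolic self-map of the disk fixing `1` that is a translation by `2 e` in the
half-plane. -/
noncomputable def parabolic (e : ℝ) (ζ : ℂ) : ℂ := 1 - (1 - ζ) / (1 + e * (1 - ζ))

lemma one_add_mul_one_sub_ne_zero {e : ℝ} (he : 0 ≤ e) {ζ : ℂ} (hζ : ζ ∈ disk) :
    1 + e * (1 - ζ) ≠ 0 := fun h0 => by
  have := congrArg re h0
  rw [add_re, re_ofReal_mul, one_re, zero_re] at this
  nlinarith [mul_nonneg he (re_one_sub_pos hζ).le]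

lemma parabolic_mapsTo {e : ℝ} (he : 0 ≤ e) : Set.MapsTo (parabolic e) disk disk := by
  intro ζ hζ
  have hne := one_add_mul_one_sub_ne_zero he hζ
  have h1 : parabolic e ζ = (1 + e * (1 - ζ) - (1 - ζ)) / (1 + e * (1 - ζ)) := by
    rw [parabolic, sub_div (1 + e * (1 - ζ)), div_self hne]
  rw [disk, mem_ball_zero_iff, h1, norm_div, div_lt_one (norm_pos_iff.mpr hne)]
  refine lt_of_pow_lt_pow_left₀ 2 (norm_nonneg _) ?_
  have h2 : ‖ζ‖ ^ 2 < 1 := by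
    nlinarith [norm_nonneg ζ, norm_lt_one_of_mem_disk hζ]
  simp only [← normSq_eq_norm_sq, normSq_apply, add_re, add_im, sub_re, sub_im, one_re, one_im,
    re_ofReal_mul, im_ofReal_mul] at h2 ⊢
  nlinarith [mul_nonneg he (add_nonneg (sq_nonneg (1 - ζ.re)) (sq_nonneg ζ.im))]

lemma differentiableOn_parabolic {e : ℝ} (he : 0 ≤ e) :
    DifferentiableOn ℂ (parabolic e) disk :=
  (differentiableOn_const _).sub (DifferentiableOn.div (by fun_prop) (by fun_prop)
    fun _ hζ => one_add_mul_one_sub_ne_zero he hζ)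

/-- A parabolic map moves `r` by a hyperbolic distance that vanishes as `r → 1`. -/
lemma norm_mobius_parabolic_le {e : ℝ} (he : 0 ≤ e) {r : ℝ} (hr : r ∈ Set.Ico (0 : ℝ) 1) :
    ‖mobius r (parabolic e r)‖ ≤ e * (1 - r) := by
  have hu : 0 < 1 - r := by linarith [hr.2]
  have hd : 0 < 1 + e * (1 - r) := by positivity
  set q : ℝ := 1 - (1 - r) / (1 + e * (1 - r)) with hq
  have hpq : parabolic e r = q := by
    simp [parabolic, hq]
  have hq1 : q - r = e * (1 - r) ^ 2 / (1 + e * (1 - r)) := by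
    rw [hq]
    field_simp
    ring
  have hqr : 0 ≤ q - r := by
    rw [hq1]
    positivity
  have hq2 : q - r ≤ e * (1 - r) ^ 2 := by
    rw [hq1]
    exact div_le_self (by positivity) (by nlinarith [mul_nonneg he hu.le])
  have hq3 : q ≤ 1 := by
    rw [hq]
    have := div_pos hu hd
    linarith
  have hden : 1 - r ≤ 1 - r * q := by nlinarith [hr.1]
  rw [hpq, mobius, conj_ofReal, ← ofReal_one, ← ofReal_mul, ← ofReal_sub, ← ofReal_sub,
    ← ofReal_div, norm_real, Real.norm_of_nonneg (div_nonneg hqr (by linarith)),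
    div_le_iff₀ (by linarith)]
  calc q - r ≤ e * (1 - r) * (1 - r) := by linarith
    _ ≤ e * (1 - r) * (1 - r * q) := mul_le_mul_of_nonneg_left hden (by positivity)

/-- The half-plane inequality with the radial growth rate `c₀` persists at
`bend x j r (r + s (1 - r))`: this point lies on a curve, bent by a parabolic map, that is
asymptotic to the radius and hence has the same growth rate. -/
lemma mul_cayley_le_re_bend (hx : ‖x‖ = 1) (hh : IsHol h) (hj : IsSilovComponent x j) {c₀ : ℝ}
    (hc₀ : Tendsto (fun r : ℝ => (1 - (r : ℂ)) * cayley (h ((r : ℂ) • x))) (𝓝[<] 1)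
      (𝓝 (2 * c₀)))
    {r s : ℝ} (hr : r ∈ Set.Ico (0 : ℝ) 1) (hs : s ∈ Set.Ico (0 : ℝ) 1) :
    c₀ * (cayley r).re ≤ (cayley (h (bend x j r (r + s * (1 - r))))).re := by
  have hr1 : 0 < 1 - r := by linarith [hr.2]
  have hs1 : 0 < 1 - s := by linarith [hs.2]
  -- With this `e` the parabolic map sends `r` to `r + s (1 - r)`.
  set e : ℝ := s / ((1 - s) * (1 - r)) with he_def
  have he : 0 ≤ e := div_nonneg hs.1 (by positivity)
  obtain ⟨c, hc, hlim⟩ := exists_angular_residue_bend hx hh j (differentiableOn_parabolic he)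
    (parabolic_mapsTo he)
  have hlim' := (hlim 2).comp (tendsto_ofReal_stolz one_lt_two)
  have hcmp : Tendsto (fun t : ℝ => (1 - (t : ℂ)) * cayley (h (bend x j t (parabolic e t))))
      (𝓝[<] 1) (𝓝 (2 * c₀)) := by
    refine tendsto_mul_of_gamma_tendsto_zero (F := fun z => cayley (h z))
      (differentiableOn_cayley_comp hh)
      (fun z hz => cayley_re_pos (hh.mapsTo hz)) ?_ ?_ ?_ hc₀
    · filter_upwards [eventually_mem_Ico] with t ht
      exact bend_mem_polydisk hx (ofReal_mem_disk ht) (parabolic_mapsTo he (ofReal_mem_disk ht))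
    · filter_upwards [eventually_mem_Ico] with t ht
      exact smul_mem_polydisk hx (ofReal_mem_disk ht)
    · have h0 : Tendsto (fun t : ℝ => e * (1 - t)) (𝓝[<] 1) (𝓝 0) :=
        tendsto_nhdsWithin_of_tendsto_nhds (Continuous.tendsto' (by fun_prop) _ _ (by simp))
      refine squeeze_zero' (Eventually.of_forall fun _ => norm_nonneg _) ?_ h0
      filter_upwards [eventually_mem_Ico] with t ht
      exact (norm_gamma_smul_bend_le hj _ _).trans (norm_mobius_parabolic_le he ht)
  have hcc : c = c₀ := by
    have := tendsto_nhds_unique hlim' hcmp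
    exact_mod_cast mul_left_cancel₀ two_ne_zero this
  have hpar : parabolic e r = r + s * (1 - r) := by
    have h1 : (1 - (r : ℂ)) ≠ 0 := by exact_mod_cast hr1.ne'
    have h2 : (1 - (s : ℂ)) ≠ 0 := by exact_mod_cast hs1.ne'
    have h3 : 1 + (e : ℂ) * (1 - r) = 1 / (1 - s) := by
      rw [he_def]
      push_cast
      field_simp
      ring
    rw [parabolic, h3]
    field_simp
    ring
  have := hc r (ofReal_mem_disk hr)
  rwa [hcc, hpar] at this

lemma cayley_ofReal_re (r : ℝ) : (cayley r).re = (1 + r) / (1 - r) := by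
  rw [cayley, ← ofReal_one, ← ofReal_add, ← ofReal_sub, ← ofReal_div, ofReal_re]

lemma add_mul_one_sub_mem_disk {s : ℝ} (hs : s ∈ Set.Ico (0 : ℝ) 1) {ζ : ℂ} (hζ : ζ ∈ disk) :
    ζ + s * (1 - ζ) ∈ disk := by
  have h1 := norm_lt_one_of_mem_disk hζ
  have h2 : ‖ζ + s * (1 - ζ)‖ ≤ (1 - s) * ‖ζ‖ + s := by
    have e : ζ + s * (1 - ζ) = ((1 - s : ℝ) : ℂ) * ζ + (s : ℂ) := by
      push_cast
      ring
    rw [e]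
    refine (norm_add_le _ _).trans_eq ?_
    rw [norm_mul, norm_real, norm_real, Real.norm_of_nonneg hs.1,
      Real.norm_of_nonneg (by linarith [hs.2])]
  rw [disk, mem_ball_zero_iff]
  nlinarith [hs.2]

/-- The growth rates `c s` of `(1 + h) / (1 - h)` along the curves
`ζ ↦ bend x j ζ (ζ + s (1 - ζ))`: they are positive by Julia's lemma, and at least `c 0`. -/
lemma exists_growth_rates (hx : ‖x‖ = 1) (hh : IsHol h) (hj : IsSilovComponent x j) {C : ℝ}
    (hC : 0 < C) (hJ : ∀ t ∈ Set.Ico (0 : ℝ) 1, ‖1 - h ((t : ℂ) • x)‖ ^ 2 ≤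
      C * (1 - t) * (1 - ‖h ((t : ℂ) • x)‖ ^ 2)) :
    ∃ c : ℝ → ℝ, 0 < c 0 ∧ (∀ s ∈ Set.Ico (0 : ℝ) 1, c 0 ≤ c s) ∧
      ∀ s ∈ Set.Ico (0 : ℝ) 1, ∀ M : ℝ,
        Tendsto (fun ζ => (1 - ζ) * cayley (h (bend x j ζ (ζ + s * (1 - ζ)))))
          (𝓝[stolz 1 M] 1) (𝓝 (2 * c s)) := by
  have hex : ∀ s : ℝ, ∃ c : ℝ, s ∈ Set.Ico (0 : ℝ) 1 → ∀ M : ℝ,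
      Tendsto (fun ζ => (1 - ζ) * cayley (h (bend x j ζ (ζ + s * (1 - ζ)))))
        (𝓝[stolz 1 M] 1) (𝓝 (2 * c)) := fun s => by
    by_cases hs : s ∈ Set.Ico (0 : ℝ) 1
    · obtain ⟨c, -, hc⟩ := exists_angular_residue_bend hx hh j
        (m := fun ζ => ζ + s * (1 - ζ)) (by fun_prop)
        (fun ζ hζ => add_mul_one_sub_mem_disk hs hζ)
      exact ⟨c, fun _ => hc⟩
    · exact ⟨0, fun h => absurd h hs⟩
  choose c hc using hex
  have h00 : (0 : ℝ) ∈ Set.Ico (0 : ℝ) 1 := ⟨le_rfl, one_pos⟩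
  have hlim : ∀ s ∈ Set.Ico (0 : ℝ) 1, Tendsto (fun r : ℝ => (1 - (r : ℂ)) *
      cayley (h (bend x j r (r + s * (1 - r))))) (𝓝[<] 1) (𝓝 (2 * c s)) := fun s hs =>
    (hc s hs 2).comp (tendsto_ofReal_stolz one_lt_two)
  have hlim0 : Tendsto (fun r : ℝ => (1 - (r : ℂ)) * cayley (h ((r : ℂ) • x))) (𝓝[<] 1)
      (𝓝 (2 * c 0)) := by
    simpa [bend_self] using hlim 0 h00
  have hre : ∀ (r : ℝ) (w : ℂ), ((1 - (r : ℂ)) * w).re = (1 - r) * w.re := fun r w => by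
    rw [← ofReal_one, ← ofReal_sub, re_ofReal_mul]
  have hre2 : ∀ a : ℝ, (2 * (a : ℂ)).re = 2 * a := fun a => by simp
  refine ⟨c, ?_, fun s hs => ?_, hc⟩
  · have h1 : 1 / C ≤ (2 * (c 0 : ℂ)).re := by
      refine ge_of_tendsto ((continuous_re.tendsto _).comp hlim0) ?_
      filter_upwards [eventually_mem_Ico] with t ht
      have ht1 : 0 < 1 - t := by linarith [ht.2]
      have hd := one_sub_ne_zero_of_mem_disk
        (hh.mapsTo (smul_mem_polydisk hx (ofReal_mem_disk ht)))
      have hd' : 0 < ‖1 - h ((t : ℂ) • x)‖ ^ 2 := pow_pos (norm_pos_iff.mpr hd) 2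
      rw [Function.comp_apply, hre, cayley_re, ← mul_div_assoc, div_le_div_iff₀ hC hd']
      linarith [hJ t ht]
    rw [hre2] at h1
    have := one_div_pos.mpr hC
    linarith
  · have h1 : (2 * (c 0 : ℂ)).re ≤ (2 * (c s : ℂ)).re := by
      have hl : Tendsto (fun r : ℝ => c 0 * (1 + r)) (𝓝[<] 1) (𝓝 (2 * (c 0 : ℂ)).re) := by
        refine tendsto_nhdsWithin_of_tendsto_nhds (Continuous.tendsto' (by fun_prop) _ _ ?_)
        rw [hre2]
        ring
      refine le_of_tendsto_of_tendsto hl ((continuous_re.tendsto _).comp (hlim s hs)) ?_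
      filter_upwards [eventually_mem_Ico] with r hr
      have hr1 : 0 < 1 - r := by linarith [hr.2]
      have := mul_le_mul_of_nonneg_left (mul_cayley_le_re_bend hx hh hj hlim0 hr hs) hr1.le
      rw [Function.comp_apply, hre]
      refine le_trans (le_of_eq ?_) this
      rw [cayley_ofReal_re]
      field_simp
    rw [hre2, hre2] at h1
    linarith

end

/-! ### Perturbing one component along a special restricted curve -/

section

variable {ζ a : ℂ}

lemma norm_sub_le_of_norm_mobius_le {r : ℝ} (hζ : ‖ζ‖ < 1) (ha : ‖a‖ < 1) (hr1 : r < 1)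
    (h : ‖mobius ζ a‖ ≤ r) : ‖a - ζ‖ ≤ 2 * r / (1 - r) * (1 - ‖ζ‖) := by
  have hr0 : 0 ≤ r := (norm_nonneg _).trans h
  have hden := norm_pos_iff.mpr (one_sub_conj_mul_ne_zero hζ ha)
  rw [mobius, norm_div, div_le_iff₀ hden] at h
  have h1 : ‖1 - conj ζ * a‖ ≤ (1 - ‖ζ‖ ^ 2) + ‖a - ζ‖ := by
    have e : 1 - conj ζ * a = ((1 - ‖ζ‖ ^ 2 : ℝ) : ℂ) - conj ζ * (a - ζ) := by
      have := mul_conj ζ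
      rw [normSq_eq_norm_sq] at this
      push_cast at this ⊢
      linear_combination -this
    rw [e]
    refine (norm_sub_le _ _).trans (add_le_add ?_ ?_)
    · rw [norm_real, Real.norm_of_nonneg (by nlinarith [norm_nonneg ζ])]
    · rw [norm_mul, RCLike.norm_conj]
      exact mul_le_of_le_one_left (norm_nonneg _) hζ.le
  rw [div_mul_eq_mul_div, le_div_iff₀ (by linarith)]
  nlinarith [mul_le_mul_of_nonneg_left h1 hr0,
    mul_le_mul_of_nonneg_left (by nlinarith [norm_nonneg ζ] : 1 - ‖ζ‖ ^ 2 ≤ 2 * (1 - ‖ζ‖)) hr0]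

lemma one_sub_norm_le_norm_one_sub_conj_mul {b : ℂ} (hb : ‖b‖ ≤ 1) :
    1 - ‖a‖ ≤ ‖1 - conj a * b‖ := by
  have h1 := norm_sub_norm_le 1 (conj a * b)
  rw [norm_one, norm_mul, RCLike.norm_conj] at h1
  nlinarith [norm_nonneg a]

/-- A perturbation of `a` that is small on the scale `1 - |ζ|` stays in the disk, and close to `a`
in the hyperbolic sense, as soon as `a` is hyperbolically close to `ζ`. -/
lemma norm_add_lt_one_and_norm_mobius_le {b : ℂ} (hζ : ‖ζ‖ < 1) (ha : ‖a‖ < 1)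
    (h : ‖mobius ζ a‖ ≤ 1 / 5) (hb : ‖b‖ ≤ (1 - ‖ζ‖) / 16) :
    ‖a + b‖ < 1 ∧ ‖mobius a (a + b)‖ ≤ 1 / 8 := by
  have h1 := norm_sub_le_of_norm_mobius_le hζ ha (by norm_num) h
  have h2 : ‖a‖ ≤ ‖ζ‖ + ‖a - ζ‖ := by
    simpa using norm_add_le ζ (a - ζ)
  norm_num at h1
  have h3 : ‖a + b‖ < 1 := by linarith [norm_add_le a b]
  refine ⟨h3, ?_⟩
  have h4 := one_sub_norm_le_norm_one_sub_conj_mul (a := a) h3.le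
  rw [mobius, norm_div, add_sub_cancel_left, div_le_iff₀ (by linarith)]
  linarith

/-- Two points that are hyperbolically close stay so when both are moved by `s (1 - ζ)`. -/
lemma norm_mobius_add_add_le {r s : ℝ} (hs : s ∈ Set.Ico (0 : ℝ) 1) (hζ : ζ ∈ disk)
    (ha : ‖a‖ < 1) (hr1 : r < 1) (h : ‖mobius ζ a‖ ≤ r)
    (has : ‖a + s * (1 - ζ)‖ < 1) :
    ‖mobius (ζ + s * (1 - ζ)) (a + s * (1 - ζ))‖ ≤ 2 * r / ((1 - r) * (1 - s)) := by
  have hζ1 := norm_lt_one_of_mem_disk hζ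
  have h1 := norm_sub_le_of_norm_mobius_le hζ1 ha hr1 h
  have hm := norm_lt_one_of_mem_disk (add_mul_one_sub_mem_disk hs hζ)
  have h4 := one_sub_norm_le_norm_one_sub_conj_mul (a := ζ + s * (1 - ζ)) has.le
  have hs1 : 0 < 1 - s := by linarith [hs.2]
  have hr0 : 0 ≤ r := (norm_nonneg _).trans h
  have h5 : (1 - s) * (1 - ‖ζ‖) ≤ 1 - ‖ζ + s * (1 - ζ)‖ := by
    have e : ζ + s * (1 - ζ) = ((1 - s : ℝ) : ℂ) * ζ + (s : ℂ) := by
      push_cast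
      ring
    have := norm_add_le (((1 - s : ℝ) : ℂ) * ζ) (s : ℂ)
    rw [← e, norm_mul, norm_real, norm_real, Real.norm_of_nonneg hs.1,
      Real.norm_of_nonneg hs1.le] at this
    linarith
  rw [mobius, norm_div, div_le_iff₀ (by linarith)]
  calc ‖a + s * (1 - ζ) - (ζ + s * (1 - ζ))‖ = ‖a - ζ‖ := by ring_nf
    _ ≤ 2 * r / (1 - r) * (1 - ‖ζ‖) := h1
    _ = 2 * r / ((1 - r) * (1 - s)) * ((1 - s) * (1 - ‖ζ‖)) := by
      field_simp
    _ ≤ _ := by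
      refine mul_le_mul_of_nonneg_left (h5.trans h4) ?_
      exact div_nonneg (by linarith) (mul_nonneg (by linarith) hs1.le)

end

section

variable {n : ℕ} {x : Fin n → ℂ} {j : Fin n} {h : (Fin n → ℂ) → ℂ}

/-- The point `z` with its `j`-th component moved by `b x_j`. -/
noncomputable def shift (x : Fin n → ℂ) (j : Fin n) (z : Fin n → ℂ) (b : ℂ) : Fin n → ℂ :=
  z + (b * x j) • Pi.single j 1

lemma shift_same (z : Fin n → ℂ) (b : ℂ) : shift x j z b j = z j + b * x j := by simp [shift]

lemma shift_of_ne {i : Fin n} (hi : i ≠ j) (z : Fin n → ℂ) (b : ℂ) : shift x j z b i = z i := by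
  simp [shift, hi]

/-- The component `z_j` in the coordinate in which `x_j` is `1`. -/
lemma mul_conj_mul_self (hj : IsSilovComponent x j) (w : ℂ) : w * conj (x j) * x j = w := by
  have : x j * conj (x j) = 1 := by
    rw [mul_conj, normSq_eq_norm_sq, show ‖x j‖ = 1 from hj]
    simp
  linear_combination w * this

lemma norm_mul_conj (hj : IsSilovComponent x j) (w : ℂ) : ‖w * conj (x j)‖ = ‖w‖ := by
  rw [norm_mul, RCLike.norm_conj, show ‖x j‖ = 1 from hj, mul_one]

lemma shift_same_eq (hj : IsSilovComponent x j) (z : Fin n → ℂ) (b : ℂ) :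
    shift x j z b j = (z j * conj (x j) + b) * x j := by
  rw [shift_same, add_mul, mul_conj_mul_self hj]

lemma norm_mobius_le_norm_gamma_smul (hj : IsSilovComponent x j) (ζ : ℂ) (z : Fin n → ℂ) :
    ‖mobius ζ (z j * conj (x j))‖ ≤ ‖gamma (ζ • x) z‖ := by
  rw [← norm_mobius_mul_mul hj, mul_conj_mul_self hj]
  exact norm_le_pi_norm (gamma (ζ • x) z) j

lemma shift_mem_polydisk (hj : IsSilovComponent x j) {z : Fin n → ℂ} (hz : z ∈ polydisk n) {b : ℂ}
    (hb : ‖z j * conj (x j) + b‖ < 1) : shift x j z b ∈ polydisk n := by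
  refine mem_polydisk_iff.mpr fun i => ?_
  by_cases hi : i = j
  · subst hi
    rw [shift_same_eq hj, norm_mul, show ‖x i‖ = 1 from hj, mul_one]
    exact hb
  · rw [shift_of_ne hi]
    exact norm_apply_lt_one hz i

lemma norm_gamma_shift_le (hj : IsSilovComponent x j) (z : Fin n → ℂ) (b : ℂ) :
    ‖gamma z (shift x j z b)‖ ≤ ‖mobius (z j * conj (x j)) (z j * conj (x j) + b)‖ := by
  refine (pi_norm_le_iff_of_nonneg (norm_nonneg _)).mpr fun i => ?_
  rw [gamma_apply]
  by_cases hi : i = j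
  · subst hi
    have := norm_mobius_mul_mul hj (z i * conj (x i)) (z i * conj (x i) + b)
    rw [mul_conj_mul_self hj, ← shift_same_eq hj] at this
    exact this.le
  · rw [shift_of_ne hi]
    simp only [mobius, sub_self, zero_div, norm_zero]
    exact norm_nonneg _

lemma norm_gamma_bend_shift_le (hj : IsSilovComponent x j) (z : Fin n → ℂ) (ζ μ b : ℂ) :
    ‖gamma (bend x j ζ μ) (shift x j z b)‖ ≤
      max ‖gamma (ζ • x) z‖ ‖mobius μ (z j * conj (x j) + b)‖ := by
  refine (pi_norm_le_iff_of_nonneg (by positivity)).mpr fun i => ?_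
  rw [gamma_apply]
  by_cases hi : i = j
  · subst hi
    rw [bend_same, shift_same_eq hj, norm_mobius_mul_mul hj]
    exact le_max_right _ _
  · rw [bend_of_ne hi, shift_of_ne hi]
    exact (norm_le_pi_norm (gamma (ζ • x) z) i).trans (le_max_left _ _)

/-- Points at Kobayashi distance tending to `0` also approach each other pseudohyperbolically. -/
lemma tendsto_gamma_of_tendsto_kobayashiDist {T : Type*} {l : Filter T} {a b : T → Fin n → ℂ}
    (ha : ∀ᶠ t in l, a t ∈ polydisk n) (hb : ∀ᶠ t in l, b t ∈ polydisk n)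
    (hk : Tendsto (fun t => kobayashiDist (a t) (b t)) l (𝓝 0)) :
    Tendsto (fun t => ‖gamma (b t) (a t)‖) l (𝓝 0) := by
  have h1 : Tendsto (fun t => Real.exp (2 * kobayashiDist (a t) (b t))) l (𝓝 1) := by
    simpa using (hk.const_mul 2).rexp
  have h2 : Tendsto (fun t => (Real.exp (2 * kobayashiDist (a t) (b t)) - 1) /
      (Real.exp (2 * kobayashiDist (a t) (b t)) + 1)) l (𝓝 0) := by
    have := (h1.sub_const 1).div (h1.add_const 1) (by norm_num)
    rwa [sub_self, zero_div] at this
  refine h2.congr' ?_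
  filter_upwards [ha, hb] with t hat hbt
  rw [norm_gamma_comm]
  have hr1 := norm_gamma_lt_one hat hbt
  have hr0 := norm_nonneg (gamma (a t) (b t))
  set r := ‖gamma (a t) (b t)‖ with hr
  have h3 : 0 < 1 - r := by linarith
  have e : Real.exp (2 * kobayashiDist (a t) (b t)) = (1 + r) / (1 - r) := by
    rw [kobayashiDist, ← hr, ← mul_assoc, mul_one_div_cancel two_ne_zero, one_mul,
      Real.exp_log (by positivity)]
  rw [e]
  field_simp
  ring

lemma one_sub_mul_cayley_add_one {w : ℂ} (hw : w ∈ disk) : (1 - w) * (cayley w + 1) = 2 := by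
  have := one_sub_ne_zero_of_mem_disk hw
  rw [cayley]
  field_simp
  ring

lemma cayley_add_one_ne_zero {w : ℂ} (hw : w ∈ disk) : cayley w + 1 ≠ 0 := fun h0 => by
  have := congrArg re h0
  rw [add_re, one_re, zero_re] at this
  linarith [cayley_re_pos hw]

lemma norm_cayley_le_norm_add_one {w : ℂ} (hw : w ∈ disk) : ‖cayley w‖ ≤ ‖cayley w + 1‖ := by
  refine abs_le_of_sq_le_sq' ?_ (norm_nonneg _) |>.2
  simp only [← normSq_eq_norm_sq, normSq_apply, add_re, add_im, one_re, one_im]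
  nlinarith [cayley_re_pos hw]

/-- Along a special restricted curve, `∂h/∂z_j` converges, and its limit is determined by the
growth rates `c s`: it is minus the right derivative of `1 / c` at `0`, up to the factor
`conj (x j)`. -/
lemma exists_tendsto_partialDeriv (hx : ‖x‖ = 1) (hh : IsHol h) (hj : IsSilovComponent x j)
    {c : ℝ → ℝ} (hc0 : 0 < c 0) (hcle : ∀ s ∈ Set.Ico (0 : ℝ) 1, c 0 ≤ c s)
    (hc : ∀ s ∈ Set.Ico (0 : ℝ) 1, ∀ M : ℝ,
      Tendsto (fun ζ => (1 - ζ) * cayley (h (bend x j ζ (ζ + s * (1 - ζ)))))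
        (𝓝[stolz 1 M] 1) (𝓝 (2 * c s)))
    {σ : ℝ → Fin n → ℂ} (hσ : IsCurveTo x σ) (hsp : IsSpecial x σ) (hres : IsRestricted x σ) :
    ∃ ℓ : ℂ, Tendsto (fun t => partialDeriv h j (σ t)) (𝓝[<] 1) (𝓝 (-ℓ * conj (x j))) ∧
      Tendsto (fun s : ℝ => (1 / (c s : ℂ) - 1 / (c 0 : ℂ)) / s) (𝓝[>] 0) (𝓝 ℓ) := by
  obtain ⟨M, hM1, hM⟩ := hres
  set ζ : ℝ → ℂ := fun t => leftInv x (σ t) with hζdef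
  have hM0 : 0 < M := by linarith
  have hσp : ∀ᶠ t in 𝓝[<] (1 : ℝ), σ t ∈ polydisk n :=
    eventually_mem_Ico.mono fun t ht => hσ.mapsTo ht
  have hζ1 : Tendsto ζ (𝓝[<] 1) (𝓝[stolz 1 M] 1) := by
    refine tendsto_nhdsWithin_iff.mpr ⟨?_, hM⟩
    rw [← leftInv_self hj]
    exact (continuous_leftInv.tendsto x).comp hσ.tendsto
  have hretp : ∀ᶠ t in 𝓝[<] (1 : ℝ), ζ t • x ∈ polydisk n :=
    hM.mono fun t ht => smul_mem_polydisk hx ht.1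
  have hρ : Tendsto (fun t => ‖gamma (ζ t • x) (σ t)‖) (𝓝[<] 1) (𝓝 0) :=
    tendsto_gamma_of_tendsto_kobayashiDist hσp hretp hsp
  have hρ5 : ∀ᶠ t in 𝓝[<] (1 : ℝ), ‖gamma (ζ t • x) (σ t)‖ ≤ 1 / 5 :=
    (hρ.eventually (gt_mem_nhds (by norm_num : (0 : ℝ) < 1 / 5))).mono fun _ ht => ht.le
  set G : (Fin n → ℂ) → ℂ := fun z => cayley (h z) with hG
  have hGd : DifferentiableOn ℂ G (polydisk n) := differentiableOn_cayley_comp hh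
  have hGre : ∀ z ∈ polydisk n, 0 < (G z).re := fun z hz => cayley_re_pos (hh.mapsTo hz)
  -- Perturbations by `s (1 - ζ)` with `|s| < δ` stay in a fixed hyperbolic neighbourhood: in the
  -- Stolz region, `|s| |1 - ζ| < δ M (1 - |ζ|) = (1 - |ζ|) / 16`.
  set δ : ℝ := 1 / (16 * M) with hδdef
  have hδ : 0 < δ := by positivity
  have hδ1 : δ < 1 := by
    rw [hδdef, div_lt_one (by positivity)]
    linarith
  have hsmall : ∀ᶠ t in 𝓝[<] (1 : ℝ), ∀ s ∈ ball (0 : ℂ) δ,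
      ‖σ t j * conj (x j) + s * (1 - ζ t)‖ < 1 ∧
      ‖mobius (σ t j * conj (x j)) (σ t j * conj (x j) + s * (1 - ζ t))‖ ≤ 1 / 8 := by
    filter_upwards [hσp, hM, hρ5] with t hp ⟨hd, hst⟩ h5 s hs
    have hζn := norm_lt_one_of_mem_disk hd
    refine norm_add_lt_one_and_norm_mobius_le hζn
      ((norm_mul_conj hj _).trans_lt (norm_apply_lt_one hp j))
      ((norm_mobius_le_norm_gamma_smul hj _ _).trans h5) ?_
    have h1 : ‖1 - ζ t‖ ≤ M * (1 - ‖ζ t‖) := ((div_lt_iff₀ (by linarith)).mp hst).le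
    rw [norm_mul]
    calc ‖s‖ * ‖1 - ζ t‖ ≤ δ * (M * (1 - ‖ζ t‖)) :=
          mul_le_mul (mem_ball_zero_iff.mp hs).le h1 (norm_nonneg _) hδ.le
      _ = (1 - ‖ζ t‖) / 16 := by
        rw [hδdef]
        field_simp
  have hshiftp : ∀ᶠ t in 𝓝[<] (1 : ℝ), ∀ s ∈ ball (0 : ℂ) δ,
      shift x j (σ t) (s * (1 - ζ t)) ∈ polydisk n := by
    filter_upwards [hsmall, hσp] with t h1 hp s hs
    exact shift_mem_polydisk hj hp (h1 s hs).1
  have hGlim : ∀ s : ℝ, 0 ≤ s → s < δ →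
      Tendsto (fun t => (1 - ζ t) * G (shift x j (σ t) (s * (1 - ζ t)))) (𝓝[<] 1)
        (𝓝 (2 * c s)) := by
    intro s hs0 hsδ
    have hs : s ∈ Set.Ico (0 : ℝ) 1 := ⟨hs0, hsδ.trans hδ1⟩
    have hsb : (s : ℂ) ∈ ball (0 : ℂ) δ := by
      rwa [mem_ball_zero_iff, norm_real, Real.norm_of_nonneg hs0]
    refine tendsto_mul_of_gamma_tendsto_zero hGd hGre
      (b := fun t => bend x j (ζ t) (ζ t + s * (1 - ζ t)))
      (hshiftp.mono fun t ht => ht s hsb)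
      (hM.mono fun t ht => bend_mem_polydisk hx ht.1 (add_mul_one_sub_mem_disk hs ht.1)) ?_
      ((hc s hs M).comp hζ1)
    have hb : Tendsto (fun t => max ‖gamma (ζ t • x) (σ t)‖ (2 * ‖gamma (ζ t • x) (σ t)‖ /
        ((1 - ‖gamma (ζ t • x) (σ t)‖) * (1 - s)))) (𝓝[<] 1) (𝓝 0) := by
      have h1 : (1 - 0) * (1 - s) ≠ 0 := by
        rw [sub_zero, one_mul]
        linarith [hs.2]
      simpa using hρ.max ((hρ.const_mul 2).div ((hρ.const_sub 1).mul_const (1 - s)) h1)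
    refine squeeze_zero' (Eventually.of_forall fun _ => norm_nonneg _) ?_ hb
    filter_upwards [hσp, hM, hρ5, hsmall] with t hp hst h5 hsm
    refine (norm_gamma_bend_shift_le hj _ _ _ _).trans (max_le_max le_rfl ?_)
    exact norm_mobius_add_add_le hs hst.1
      ((norm_mul_conj hj _).trans_lt (norm_apply_lt_one hp j)) (by linarith)
      (norm_mobius_le_norm_gamma_smul hj _ _) (hsm s hsb).1
  have hζlim : Tendsto (fun t => 1 - ζ t) (𝓝[<] 1) (𝓝 0) := by
    simpa using (tendsto_nhds_of_tendsto_nhdsWithin hζ1).const_sub 1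
  -- `Q t` is holomorphic in the perturbation parameter `s`, and its derivative at `0` is
  -- `-x_j ∂h/∂z_j` at `σ t`: the factor `1 - ζ` cancels.
  set Q : ℝ → ℂ → ℂ := fun t s => (1 - h (shift x j (σ t) (s * (1 - ζ t)))) / (1 - ζ t) with hQ
  have hQeq : ∀ᶠ t in 𝓝[<] (1 : ℝ), ∀ s ∈ ball (0 : ℂ) δ,
      Q t s = 2 / ((1 - ζ t) * (G (shift x j (σ t) (s * (1 - ζ t))) + 1)) := by
    filter_upwards [hM, hshiftp] with t hst hp s hs
    have h1 := one_sub_ne_zero_of_mem_disk hst.1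
    have h2 := cayley_add_one_ne_zero (hh.mapsTo (hp s hs))
    rw [← one_sub_mul_cayley_add_one (hh.mapsTo (hp s hs)), mul_div_mul_right _ _ h2]
  have hcpos : ∀ s ∈ Set.Ico (0 : ℝ) 1, 0 < c s := fun s hs => hc0.trans_le (hcle s hs)
  have hQlim : ∀ s : ℝ, 0 ≤ s → s < δ →
      Tendsto (fun t => Q t s) (𝓝[<] 1) (𝓝 (1 / (c s : ℂ))) := by
    intro s hs0 hsδ
    have hsb : (s : ℂ) ∈ ball (0 : ℂ) δ := by
      rwa [mem_ball_zero_iff, norm_real, Real.norm_of_nonneg hs0]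
    have hcs : (c s : ℂ) ≠ 0 := by exact_mod_cast (hcpos s ⟨hs0, hsδ.trans hδ1⟩).ne'
    have h1 : Tendsto (fun t => 2 / ((1 - ζ t) * (G (shift x j (σ t) (s * (1 - ζ t))) + 1)))
        (𝓝[<] 1) (𝓝 (1 / (c s : ℂ))) := by
      have h2 := (tendsto_const_nhds (x := (2 : ℂ))).div ((hGlim s hs0 hsδ).add hζlim)
        (by simpa using hcs)
      have e : (2 : ℂ) / (2 * c s + 0) = 1 / c s := by
        rw [add_zero]
        field_simp
      rw [e] at h2
      refine h2.congr fun t => ?_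
      rw [mul_add, mul_one]
      rfl
    refine h1.congr' ?_
    filter_upwards [hQeq] with t ht
    exact (ht s hsb).symm
  have hGz : ∀ᶠ t in 𝓝[<] (1 : ℝ), c 0 < ‖(1 - ζ t) * G (σ t)‖ := by
    have h1 := (hGlim 0 le_rfl hδ).norm
    have h2 : c 0 < ‖(2 * (c 0 : ℂ))‖ := by
      rw [norm_mul, norm_real, Real.norm_of_nonneg hc0.le, RCLike.norm_ofNat]
      linarith
    refine (h1.eventually (lt_mem_nhds h2)).mono fun t ht => ?_
    simpa [shift] using ht
  have hQbd : ∀ᶠ t in 𝓝[<] (1 : ℝ), DifferentiableOn ℂ (Q t) (ball 0 δ) ∧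
      ∀ s ∈ ball (0 : ℂ) δ, ‖Q t s‖ ≤ 4 / c 0 := by
    filter_upwards [hσp, hM, hsmall, hshiftp, hQeq, hGz] with t hp hst hsm hsp hqe hgz
    refine ⟨?_, fun s hs => ?_⟩
    · refine DifferentiableOn.div_const ((differentiableOn_const _).sub
        (hh.differentiableOn.comp ?_ hsp)) _
      unfold shift
      fun_prop
    · have hh' := hh.mapsTo (hsp s hs)
      have h8 := (norm_gamma_shift_le hj (σ t) (s * (1 - ζ t))).trans (hsm s hs).2
      have h1 := norm_sub_le_of_norm_sub_le_mul_add_conj (by norm_num : (0 : ℝ) ≤ 1 / 8)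
        (by norm_num) ((norm_sub_le_gamma_of_re_pos hGd hGre hp (hsp s hs)).trans
          (mul_le_mul_of_nonneg_right h8 (norm_nonneg _)))
      norm_num at h1
      have h2 := norm_sub_norm_le (G (σ t)) (G (shift x j (σ t) (s * (1 - ζ t))))
      rw [norm_sub_rev] at h2
      have h3 : ‖G (σ t)‖ / 2 ≤ ‖G (shift x j (σ t) (s * (1 - ζ t))) + 1‖ := by
        refine le_trans ?_ (norm_cayley_le_norm_add_one hh')
        change _ ≤ ‖G _‖
        linarith [norm_nonneg (G (σ t))]
      have h4 : c 0 / 2 ≤ ‖(1 - ζ t) * (G (shift x j (σ t) (s * (1 - ζ t))) + 1)‖ := by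
        rw [norm_mul] at hgz ⊢
        nlinarith [mul_le_mul_of_nonneg_left h3 (norm_nonneg (1 - ζ t))]
      rw [hqe s hs, norm_div, RCLike.norm_ofNat]
      calc 2 / ‖(1 - ζ t) * (G (shift x j (σ t) (s * (1 - ζ t))) + 1)‖ ≤ 2 / (c 0 / 2) := by
            gcongr
        _ = 4 / c 0 := by
          field_simp
          norm_num
  obtain ⟨ℓ, hℓ, hslope⟩ := exists_tendsto_deriv hδ (A := fun s => 1 / (c s : ℂ)) hQbd hQlim
  refine ⟨ℓ, (hℓ.neg.mul_const (conj (x j))).congr' ?_, hslope⟩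
  filter_upwards [hσp, hM] with t hp hst
  have h1 : 1 - ζ t ≠ 0 := one_sub_ne_zero_of_mem_disk hst.1
  have hfd : HasFDerivAt h (fderiv ℂ h (σ t)) (shift x j (σ t) (0 * (1 - ζ t))) := by
    have e : shift x j (σ t) (0 * (1 - ζ t)) = σ t := by simp [shift]
    rw [e]
    exact (hh.differentiableOn.differentiableAt (isOpen_ball.mem_nhds hp)).hasFDerivAt
  have hsd : HasDerivAt (fun s : ℂ => shift x j (σ t) (s * (1 - ζ t)))
      (((1 - ζ t) * x j) • Pi.single j 1) 0 := by
    have h2 := ((((hasDerivAt_id (0 : ℂ)).mul_const (1 - ζ t)).mul_const (x j)).smul_const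
      (Pi.single j 1 : Fin n → ℂ)).const_add (σ t)
    simpa [shift] using h2
  have hd := ((hfd.comp_hasDerivAt (0 : ℂ) hsd).const_sub 1).div_const (1 - ζ t)
  have hd' : deriv (Q t) 0 = -(partialDeriv h j (σ t) * x j) := by
    rw [show deriv (Q t) 0 = _ from hd.deriv, map_smul, partialDeriv, smul_eq_mul]
    field_simp
  rw [hd', neg_neg, mul_right_comm]
  exact mul_conj_mul_self hj _

/-- The case `τ = 1` of the theorem, from Julia's inequality on the radius. -/
lemma exists_hasRestrictedKLimit_partialDeriv (hx : ‖x‖ = 1) (hh : IsHol h)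
    (hj : IsSilovComponent x j) {C : ℝ} (hC : 0 < C)
    (hJ : ∀ t ∈ Set.Ico (0 : ℝ) 1, ‖1 - h ((t : ℂ) • x)‖ ^ 2 ≤
      C * (1 - t) * (1 - ‖h ((t : ℂ) • x)‖ ^ 2)) :
    ∃ β : ℝ, 0 ≤ β ∧ HasRestrictedKLimit (partialDeriv h j) x (β * conj (x j)) := by
  obtain ⟨c, hc0, hcle, hc⟩ := exists_growth_rates hx hh hj hC hJ
  -- The radius is a special restricted curve; it serves to show that the slopes converge.
  obtain ⟨ℓ, -, hℓ⟩ := exists_tendsto_partialDeriv hx hh hj hc0 hcle hc (isCurveTo_radius hx)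
    (isSpecial_radius hj) (isRestricted_radius hj)
  have hslope : ∀ s : ℝ, (1 / (c s : ℂ) - 1 / (c 0 : ℂ)) / s =
      (((1 / c s - 1 / c 0) / s : ℝ) : ℂ) := fun s => by push_cast; rfl
  have him : ℓ.im = 0 := by
    refine tendsto_nhds_unique ((continuous_im.tendsto _).comp hℓ) ?_
    simp only [Function.comp_def, hslope, ofReal_im]
    exact tendsto_const_nhds
  have hre : ℓ.re ≤ 0 := by
    refine le_of_tendsto ((continuous_re.tendsto _).comp hℓ) ?_
    filter_upwards [Ioo_mem_nhdsGT one_pos] with s hs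
    rw [Function.comp_apply, hslope, ofReal_re]
    refine div_nonpos_of_nonpos_of_nonneg (sub_nonpos.mpr ?_) hs.1.le
    exact one_div_le_one_div_of_le hc0 (hcle s ⟨hs.1.le, hs.2⟩)
  refine ⟨-ℓ.re, by linarith, fun σ hσ hsp hres => ?_⟩
  obtain ⟨ℓ', h1, h2⟩ := exists_tendsto_partialDeriv hx hh hj hc0 hcle hc hσ hsp hres
  have e : ℓ' = (ℓ.re : ℂ) := by
    rw [tendsto_nhds_unique h2 hℓ]
    exact Complex.ext rfl (by rw [him, ofReal_im])
  rw [e] at h1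
  simpa using h1

end

end Polydisk

theorem proposition4p9 {n : ℕ} (f : (Fin n → ℂ) → ℂ) (hf : Polydisk.IsHol f)
    (x : Fin n → ℂ) (hx : x ∈ frontier (Polydisk.polydisk n))
    (α : ℝ) (hα : Polydisk.IsJulia α f x)
    (τ : ℂ) (hτ : τ ∈ frontier Polydisk.disk) (hE : Polydisk.HasRestrictedELimit f x τ)
    (j : Fin n) (hj : Polydisk.IsSilovComponent x j) :
    ∃ β : ℝ, 0 ≤ β ∧
      Polydisk.HasRestrictedKLimit (Polydisk.partialDeriv f j) x
        ((β : ℂ) * τ * (starRingEnd ℂ) (x j)) := by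
  have hx1 := Polydisk.norm_eq_one_of_mem_frontier hx
  have hτ1 : ‖τ‖ = 1 := mem_sphere_zero_iff_norm.mp (Metric.frontier_ball_subset_sphere hτ)
  have hττ : τ * (starRingEnd ℂ) τ = 1 := by
    rw [Complex.mul_conj, Complex.normSq_eq_norm_sq, hτ1]
    simp
  have hJ := Polydisk.norm_sub_sq_le_of_hasRestrictedELimit hx1 hf hα hE
  have hn : ∀ z, ‖(starRingEnd ℂ) τ * f z‖ = ‖f z‖ := fun z => by
    rw [norm_mul, RCLike.norm_conj, hτ1, one_mul]
  have hh : Polydisk.IsHol (fun z => (starRingEnd ℂ) τ * f z) :=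
    ⟨hf.differentiableOn.const_mul _, fun z hz => by
      rw [Polydisk.disk, mem_ball_zero_iff, hn]
      exact mem_ball_zero_iff.mp (hf.mapsTo hz)⟩
  obtain ⟨β, hβ, hlim⟩ := Polydisk.exists_hasRestrictedKLimit_partialDeriv hx1 hh hj
    (C := 16 * α) (mul_pos (by norm_num) hα.1) fun t ht => by
      have e : ‖1 - (starRingEnd ℂ) τ * f ((t : ℂ) • x)‖ = ‖τ - f ((t : ℂ) • x)‖ := by
        have : 1 - (starRingEnd ℂ) τ * f ((t : ℂ) • x) =
            (starRingEnd ℂ) τ * (τ - f ((t : ℂ) • x)) := by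
          linear_combination -hττ
        rw [this, norm_mul, RCLike.norm_conj, hτ1, one_mul]
      rw [e, hn]
      exact hJ t ht
  refine ⟨β, hβ, fun σ hσ hsp hres => ?_⟩
  have h1 := (hlim σ hσ hsp hres).const_mul τ
  have e : τ * ((β : ℂ) * (starRingEnd ℂ) (x j)) = (β : ℂ) * τ * (starRingEnd ℂ) (x j) := by ring
  rw [e] at h1
  refine h1.congr' ?_
  filter_upwards [Polydisk.eventually_mem_Ico] with t ht
  have hd : DifferentiableAt ℂ f (σ t) :=
    hf.differentiableOn.differentiableAt (Metric.isOpen_ball.mem_nhds (hσ.mapsTo ht))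
  rw [Polydisk.partialDeriv, fderiv_const_mul hd, smul_apply, smul_eq_mul,
    ← mul_assoc, hττ, one_mul]
  rfl
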